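/- **Setting.** There are $K\ge 1$ data sources; source $k\in[K]$ has two probability distributions $P_{k,1},P_{k,2}$ on a measurable space $\mathcal X$. In each time slot $t\ge 1$ a source $\delta_t$ is selected at random according to a law that is a function of $F_{t-1}$, the $\sigma$-algebra generated by $(\delta_s,X_1(s),X_2(s))_{s<t}$. Given $F_{t-1}$ and $\delta_t=k$, the observed pair $(X_1(t),X_2(t))$ has law $P_{k,1}\times P_{k,2}$. The hypotheses are $H_0$: $P_{k,1}=P_{k,2}$ for all $k$, and $H_1$: $P_{k,1}\ne P_{k,2}$ for some $k$. Let $\mathcal G$ be a class of measurable functions $g:\mathcal X\to[-\frac12,\frac12]$ and put $$D^{(k)}=\sup_{g\in\mathcal G}\mathbb E[g(X_{k,1})-g(X_{k,2})],\qquad \sigma_k^2=\sup_{g\in\mathcal G}\operatorname{Var}(g(X_{k,1})-g(X_{k,2})),\qquad (X_{k,1},X_{k,2})\sim P_{k,1}\times P_{k,2}.$$ Let $a^*$ be a source with $D^{(a^*)}=\max_kD^{(k)}$ and let $D^{(a^*)}-\max_{k\ne a^*}D^{(k)}$ be the sub-optimality gap (the maximum over the empty set is $0$ when $K=1$). A prediction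 strategy chooses for each $k$ and $t$ a function $g_{k,t}\in\mathcal G$ depending (measurably) on the data up to time $t-1$; a betting strategy chooses $\lambda_t\in[-1,1]$ depending (measurably) on the data up to time $t-1$. Put $v_t=g_{\delta_t,t}(X_1(t))-g_{\delta_t,t}(X_2(t))$, $W_0=1$, $W_t=\prod_{s\le t}(1+\lambda_sv_s)$, and $\tau=\inf\{t\ge1:W_t\ge1/\alpha\}$ for $\alpha\in(0,1)$. Let $N_{k,t}=\sum_{s\le t}\mathbf 1\{\delta_s=k\}$, $\hat\mu_{k,t}=N_{k,t}^{-1}\sum_{s\le t}v_s\mathbf 1\{\delta_s=k\}$ ($-\infty$ if $N_{k,t}=0$), and define the regret $$R^{(k)}_t=\sup_{g\in\mathcal G}\sum_{s\le t}\bigl(g(X_1(s))-g(X_2(s))-v_s\bigr)\mathbf 1\{\delta_s=k\}.$$ **The proposed test** is given a number $L>0$, a lower bound of the sub-optimality gap. It uses $$C=K(c_1+40K)+4K\sqrt{5K(c_1+20K)},\quad c_1=2560/L^2,\qquad \epsilon(t)=\min\{1,C/t\};$$ in slot $t$, with probability $1-\epsilon(t)$ it selects a source maximizing $\hat\mu_{k,t-1}$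 (ties broken arbitrarily), and with probability $\epsilon(t)$ a uniformly random source. Its bets are those of the online Newton step: $\lambda_1=0$, $a_0=1$, $z_t=v_t/(1+\lambda_tv_t)$, $a_t=a_{t-1}+z_t^2$, and $\lambda_{t+1}$ is $\lambda_t+\frac{2}{2-\log3}\frac{z_t}{a_t}$ clipped to $[-\frac12,\frac12]$. **Assumptions.** (1) The sub-optimality gap is positive (and at least $L>0$). (2) $D^{(k)}>0$ for some $k$. (3) $g\in\mathcal G$ implies $-g\in\mathcal G$. **Theorem.** (i) *Level $\alpha$.* Under (3), for all prediction, betting and selection strategies as above and every $\alpha\in(0,1)$, $\mathbb P_{H_0}(\tau<\infty)\le\alpha$ for all distributions satisfying $H_0$. (ii) *Power one.* Let the proposed test be used with any prediction strategy. Under (1)–(3) and $H_1$, if almost surely $$\limsup_{t\to\infty}\Bigl(\frac{R^{(a^*)}_t}{t}-\frac1t\sum_{s=1}^tD^{(a^*)}\mathbf 1\{\delta_s=a^*\}\Bigr)<0,$$ then $\mathbb P_{H_1}(\tau<\infty)=1$. (iii) *Expected stopping time.* There are a constant $c\ge 0$ and an integer $q\ge 0$, both universal, and for each $M$ a constant $c_M$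 depending only on $M$, such that the following holds. Let the proposed test be used with a prediction strategy for which almost surely $R^{(a^*)}_t\le M\sqrt{N_{a^*,t}}$ for all $t$. Let (1)–(3) and $H_1$ hold, and let $r_t\ge0$ be numbers with $r_t\to0$ and $\sum_{t\ge1}\mathbb P(E_{t,a^*}^c)<\infty$, where $E_{t,a^*}=\{R^{(a^*)}_t/t\le r_t\}$. Then $$\mathbb E_{H_1}[\tau]\le c\Bigl(t_0+\sum_{t\ge1}\mathbb P(E_{t,a^*}^c)+T_{\rm explore}\Bigr),\qquad T_{\rm explore}=c_M\,\frac{K^3}{L^6}\bigl(1+\log(K/L)\bigr)^q,$$ where $$t_0=\inf\Bigl\{t\ge1:\ D^{(a^*)}\ge r_t+\sigma_{a^*}\sqrt{\frac{\log(t/\alpha)}t}+\frac{\log(t/\alpha)}t\Bigr\}.$$ -/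

import Mathlib

open MeasureTheory ProbabilityTheory Filter Topology
open scoped ENNReal NNReal

namespace ActiveTest

noncomputable section

/-- What is seen in one time slot: the selected source and the pair of samples it returns. -/
abbrev Obs (K : ℕ) (𝒳 : Type*) := Fin K × 𝒳 × 𝒳

/-- What has been seen in the first `n` time slots. Entry `i : Fin n` belongs to time slot
`i + 1`. Measurable functions of `Hist K 𝒳 n` are the functions measurable with respect to the
natural filtration at time `n`. -/
abbrev Hist (K : ℕ) (𝒳 : Type*) (n : ℕ) := Fin n → Obs K 𝒳

variable {K : ℕ} {𝒳 : Type*}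

/-- The part of a history that precedes its entry `i`. -/
def Hist.before {n : ℕ} (h : Hist K 𝒳 n) (i : Fin n) : Hist K 𝒳 i :=
  fun j => h (Fin.castLE i.isLt.le j)

/-! ### The class of test functions and the distances -/

/-- A class of measurable test functions with values in `[-1/2, 1/2]`. -/
def IsTestClass [MeasurableSpace 𝒳] (G : Set (𝒳 → ℝ)) : Prop :=
  ∀ g ∈ G, Measurable g ∧ ∀ x, g x ∈ Set.Icc (-(1 / 2) : ℝ) (1 / 2)

/-- The class is closed under negation. -/
def IsSymmetricClass (G : Set (𝒳 → ℝ)) : Prop := ∀ g ∈ G, -g ∈ G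

/-- `sup_{g ∈ G} E[g(X₁) - g(X₂)]` for `(X₁, X₂) ∼ P × Q`. -/
def dist [MeasurableSpace 𝒳] (G : Set (𝒳 → ℝ)) (P Q : Measure 𝒳) : ℝ :=
  sSup ((fun g : 𝒳 → ℝ => ∫ x, (g x.1 - g x.2) ∂(P.prod Q)) '' G)

/-- The square root of `sup_{g ∈ G} Var(g(X₁) - g(X₂))` for `(X₁, X₂) ∼ P × Q`. -/
def stdev [MeasurableSpace 𝒳] (G : Set (𝒳 → ℝ)) (P Q : Measure 𝒳) : ℝ :=
  Real.sqrt (sSup ((fun g : 𝒳 → ℝ =>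
    variance (fun x : 𝒳 × 𝒳 => g x.1 - g x.2) (P.prod Q)) '' G))

/-- The sub-optimality gap `D^{(a)} - max_{k ≠ a} D^{(k)}`. For a single source the maximum over
the empty set is `0`, the least value that a distance can take. -/
def gap [MeasurableSpace 𝒳] (G : Set (𝒳 → ℝ)) (P Q : Fin K → Measure 𝒳) (a : Fin K) : ℝ :=
  dist G (P a) (Q a) - ⨆ k : {k : Fin K // k ≠ a}, dist G (P k) (Q k)

/-! ### Strategies -/

/-- `A k n h` is the test function used for source `k` in time slot `n + 1` after the
history `h`. -/
abbrev Prediction (K : ℕ) (𝒳 : Type*) := Fin K → (n : ℕ) → Hist K 𝒳 n → 𝒳 → ℝ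

/-- `B n h` is the bet made in time slot `n + 1` after the history `h`. -/
abbrev Betting (K : ℕ) (𝒳 : Type*) := (n : ℕ) → Hist K 𝒳 n → ℝ

/-- `π n h` is the law of the source selected in time slot `n + 1` after the history `h`. -/
abbrev Selection (K : ℕ) (𝒳 : Type*) [MeasurableSpace 𝒳] :=
  (n : ℕ) → Kernel (Hist K 𝒳 n) (Fin K)

/-- The predictions lie in `G` and depend measurably on the past and on the sample. -/
structure IsPrediction [MeasurableSpace 𝒳] (G : Set (𝒳 → ℝ)) (A : Prediction K 𝒳) : Prop where
  mem : ∀ k n h, A k n h ∈ G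
  measurable : ∀ k n, Measurable fun x : Hist K 𝒳 n × 𝒳 => A k n x.1 x.2

/-- The bets lie in `[-1, 1]` and depend measurably on the past. -/
structure IsBetting [MeasurableSpace 𝒳] (B : Betting K 𝒳) : Prop where
  mem : ∀ n h, B n h ∈ Set.Icc (-1 : ℝ) 1
  measurable : ∀ n, Measurable (B n)

/-! ### Quantities computed from a history -/

/-- The payoff `g(X₁) - g(X₂)` of the time slot recorded in entry `i`, where `g` is the prediction
for the source selected there. -/
def payoff (A : Prediction K 𝒳) {n : ℕ} (h : Hist K 𝒳 n) (i : Fin n) : ℝ :=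
  A (h i).1 i (h.before i) (h i).2.1 - A (h i).1 i (h.before i) (h i).2.2

/-- How often source `k` has been selected. -/
def count (k : Fin K) {n : ℕ} (h : Hist K 𝒳 n) : ℕ :=
  ∑ i, if (h i).1 = k then 1 else 0

/-- The running average of the payoffs of source `k`, `-∞` if it was never selected. -/
def empMean (A : Prediction K 𝒳) (k : Fin K) {n : ℕ} (h : Hist K 𝒳 n) : EReal :=
  if count k h = 0 then ⊥
  else (((∑ i, if (h i).1 = k then payoff A h i else 0) / (count k h : ℝ) : ℝ) : EReal)

/-- The individual regret of the predictions for source `k`. -/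
def regret (G : Set (𝒳 → ℝ)) (A : Prediction K 𝒳) (k : Fin K) {n : ℕ} (h : Hist K 𝒳 n) : ℝ :=
  sSup ((fun g : 𝒳 → ℝ =>
    (∑ i, if (h i).1 = k then g (h i).2.1 - g (h i).2.2 else 0)
      - ∑ i, if (h i).1 = k then payoff A h i else 0) '' G)

/-- The betting wealth `∏ (1 + λ v)`. -/
def wealth (A : Prediction K 𝒳) (B : Betting K 𝒳) {n : ℕ} (h : Hist K 𝒳 n) : ℝ :=
  ∏ i : Fin n, (1 + B i (h.before i) * payoff A h i)

/-! ### The online Newton step bets -/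

/-- The pair `(λ, a)` of the online Newton step for the functions `λ ↦ log (1 + λ v)`, after the
payoffs `v 0, …, v (n - 1)`. -/
def onsState (v : ℕ → ℝ) : ℕ → ℝ × ℝ
  | 0 => (0, 1)
  | n + 1 =>
    let l := (onsState v n).1
    let z := v n / (1 + v n * l)
    let a := (onsState v n).2 + z ^ 2
    (min (1 / 2) (max (-(1 / 2)) (l + 2 / (2 - Real.log 3) * (z / a))), a)

/-- The online Newton step betting strategy, run on the payoffs of the selected sources. -/
def onsBetting (A : Prediction K 𝒳) : Betting K 𝒳 := fun n h =>
  (onsState (fun i => if hi : i < n then payoff A h ⟨i, hi⟩ else 0) n).1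

/-! ### The selection rule -/

/-- The exploration constant `C`, for `K` sources and the known lower bound `L` of the gap. -/
def explorationConst (K : ℕ) (L : ℝ) : ℝ :=
  K * (2560 / L ^ 2 + 40 * K) + 4 * K * Real.sqrt (5 * K * (2560 / L ^ 2 + 20 * K))

/-- The exploration rate `ε(t) = min {1, C / t}`. -/
def explorationRate (C : ℝ) (t : ℕ) : ℝ := min 1 (C / t)

/-- `π` is an `ε(t)`-greedy selection rule: with probability `1 - ε(t)` a source with the largest
running average is taken (ties are broken in any way, possibly at random), with probability
`ε(t)` a uniformly distributed one. -/
def IsEpsGreedy [MeasurableSpace 𝒳] (A : Prediction K 𝒳) (C : ℝ) (π : Selection K 𝒳) : Prop :=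
  ∃ ρ : Selection K 𝒳, ∀ n, IsMarkovKernel (ρ n) ∧ ∀ h : Hist K 𝒳 n, ∀ k,
    (ρ n h {k} ≠ 0 → ∀ j, empMean A j h ≤ empMean A k h) ∧
    π n h {k} = ENNReal.ofReal (1 - explorationRate C (n + 1)) * ρ n h {k}
      + ENNReal.ofReal (explorationRate C (n + 1) / K)

/-! ### The stochastic model -/

variable {Ω : Type*}

/-- The history of the first `n` time slots along the outcome `ω`. -/
def history (Y : ℕ → Ω → Obs K 𝒳) (n : ℕ) (ω : Ω) : Hist K 𝒳 n := fun i => Y i ω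

/-- `Y n` is what is seen in time slot `n + 1`: given the history `h` of the first `n` slots, the
source has law `π n h` and, given also that source `k` is selected, the pair of samples has law
`P k × Q k`. -/
structure IsSampling [MeasurableSpace 𝒳] [MeasurableSpace Ω] (μ : Measure Ω)
    (P Q : Fin K → Measure 𝒳) (π : Selection K 𝒳) (Y : ℕ → Ω → Obs K 𝒳) : Prop where
  measurable : ∀ n, Measurable (Y n)
  law : ∀ (n : ℕ) (k : Fin K) (H : Set (Hist K 𝒳 n)) (S T : Set 𝒳),
    MeasurableSet H → MeasurableSet S → MeasurableSet T →
    μ {ω | history Y n ω ∈ H ∧ (Y n ω).1 = k ∧ (Y n ω).2.1 ∈ S ∧ (Y n ω).2.2 ∈ T}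
      = (∫⁻ ω in {ω | history Y n ω ∈ H}, π n (history Y n ω) {k} ∂μ) * P k S * Q k T

/-- The stopping time: the first `t ≥ 1` at which the wealth is at least `1 / α`, or `∞`. -/
def stopTime (A : Prediction K 𝒳) (B : Betting K 𝒳) (α : ℝ) (Y : ℕ → Ω → Obs K 𝒳) (ω : Ω) : ℕ∞ :=
  ⨅ (t : ℕ) (_ : 1 ≤ t ∧ 1 / α ≤ wealth A B (history Y t ω)), (t : ℕ∞)

/-- The first `t ≥ 1` with `D ≥ r t + σ √(log (t / α) / t) + log (t / α) / t`, or `∞`. -/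
def detectionTime (D σ α : ℝ) (r : ℕ → ℝ) : ℕ∞ :=
  ⨅ (t : ℕ) (_ : 1 ≤ t ∧
    r t + σ * Real.sqrt (Real.log (t / α) / t) + Real.log (t / α) / t ≤ D), (t : ℕ∞)

/-- The setting under the alternative: some source has two different distributions, source `a` has
the largest distance, the sub-optimality gap is at least the known `L > 0`, some distance is
positive, the class is symmetric, and the data come from the `ε(t)`-greedy selection rule. -/
structure IsAlternative [MeasurableSpace 𝒳] [MeasurableSpace Ω] (μ : Measure Ω)
    (G : Set (𝒳 → ℝ)) (P Q : Fin K → Measure 𝒳) (a : Fin K) (L : ℝ) (A : Prediction K 𝒳)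
    (π : Selection K 𝒳) (Y : ℕ → Ω → Obs K 𝒳) : Prop where
  testClass : IsTestClass G
  alternative : ∃ k, P k ≠ Q k
  best : ∀ k, dist G (P k) (Q k) ≤ dist G (P a) (Q a)
  L_pos : 0 < L
  L_le_gap : L ≤ gap G P Q a
  distinguishable : ∃ k, 0 < dist G (P k) (Q k)
  symmetric : IsSymmetricClass G
  prediction : IsPrediction G A
  greedy : IsEpsGreedy A (explorationConst K L) π
  sampling : IsSampling μ P Q π Y

end

end ActiveTest


universe u v

/-! ### Conditional laws of one slot and exponential tail bounds -/

namespace ActiveTest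

variable {K : ℕ} {𝒳 Ω : Type*} [MeasurableSpace 𝒳] [MeasurableSpace Ω]
  {μ : Measure Ω} {P Q : Fin K → Measure 𝒳} {π : Selection K 𝒳} {Y : ℕ → Ω → Obs K 𝒳}

/-! ### One time slot -/

/-! Level. Under the null the two samples of a slot are exchangeable given the past, so every payoff
has conditional mean zero and the wealth is a nonnegative martingale started at 1. Freezing it at
the first crossing of `1 / α` reduces the maximal inequality to Markov's inequality
(`measure_crossed_le`).

Growth of the wealth. The online Newton step has logarithmic regret against any constant bet `u` in
`[-1/2, 1/2]` (`ons_regret`), and `log (1 + x) ≥ x - x²` there. So the log-wealth is at least `u S -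
u² V - O(log n)`, with `S` the sum of the payoffs and `V` that of their squares
(`ons_log_wealth_ge`). Under the alternative it remains to bound `S` below and `V` above and to
choose `u`.

Power one. The limsup condition and concentration for a near-maximizing test function make the
payoff sum of the best source grow linearly. From then on a source can lead only while its own sum
is positive, so another source loses more than a bounded amount only in slots that select a
non-leader, and these are `o(n)` in number (`payoffSum_ge_of_leader_pos`). Hence `S` grows linearly,
and a small constant `u` makes the wealth diverge (`exists_le_wealth_of_payoffSum`).

Expected time. Write `m` for `horizonScale M` and let `t ≥ m⁶ K³ / L⁶`. Outside an event of
probability at most `4 / t²` the following holds: from slot `Lt/64` on, exploration has made all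
averages accurate and the best source is the only leader (`measure_exists_isLeader_le`). Then all
but `Lt/16` slots go to it, so `S ≥ D t / 2` and `V ≤ t (2σ² + 4D)` (`exists_bad_set`). The best `u`
for these two bounds makes the wealth cross as soon as also `t ≥ 192 t₀` (`le_wealth_of_sums`,
`log_mul_le_of_detection`). The failure probabilities are summable, so the expectation is at most
`192 t₀` plus a constant times `K³ / L⁶` (`lintegral_stopTime_le`). All tail bounds come from one
source: a product of factors with conditional mean at most 1 has mean at most 1
(`lintegral_prod_le_one`). -/

theorem measurable_history (hY : ∀ n, Measurable (Y n)) (n : ℕ) : Measurable (history Y n) :=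
  measurable_pi_lambda _ fun i => hY i

theorem measurable_before {n : ℕ} (i : Fin n) :
    Measurable fun h : Hist K 𝒳 n => h.before i :=
  measurable_pi_lambda _ fun _ => measurable_pi_apply _

/-- The joint law of a history and of the samples returned by source `k` in the next slot. -/
theorem map_restrict_history_eq_prod [IsProbabilityMeasure μ] [∀ k, IsProbabilityMeasure (P k)]
    [∀ k, IsProbabilityMeasure (Q k)] [∀ n, IsMarkovKernel (π n)]
    (hY : IsSampling μ P Q π Y) (n : ℕ) (k : Fin K) :
    (μ.restrict {ω | (Y n ω).1 = k}).map (fun ω => (history Y n ω, (Y n ω).2))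
      = ((μ.withDensity fun ω => π n (history Y n ω) {k}).map (history Y n)).prod
          ((P k).prod (Q k)) := by
  have hH := measurable_history hY.measurable n
  have hm : Measurable fun ω => π n (history Y n ω) {k} :=
    ((π n).measurable_coe (measurableSet_singleton k)).comp hH
  have hfin : IsFiniteMeasure (μ.withDensity fun ω => π n (history Y n ω) {k}) := by
    refine isFiniteMeasure_withDensity (ne_top_of_le_ne_top (b := 1) ENNReal.one_ne_top ?_)
    calc _ ≤ ∫⁻ _, 1 ∂μ := lintegral_mono fun ω => prob_le_one
      _ = 1 := by simp
  have hJ : Measurable fun ω => (history Y n ω, (Y n ω).2) :=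
    hH.prodMk (measurable_snd.comp (hY.measurable n))
  -- The sampling hypothesis speaks only of rectangles; finite measures on the triple product are
  -- determined by them.
  refine Measure.ext_prod₃ fun {H S T} hHm hS hT => ?_
  rw [Measure.map_apply hJ (hHm.prod (hS.prod hT)), Measure.restrict_apply (hJ (hHm.prod (hS.prod hT))),
    Measure.prod_prod, Measure.prod_prod, Measure.map_apply hH hHm, withDensity_apply _ (hH hHm),
    ← mul_assoc]
  have := hY.law n k H S T hHm hS hT
  refine Eq.trans (congrArg μ ?_) this
  ext ω
  simp only [Set.mem_inter_iff, Set.mem_preimage, Set.mem_prod, Set.mem_ofPred_eq]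
  tauto

/-- The tower property for one slot: splitting by the selected source leaves an integral over a
product law for each source. -/
theorem lintegral_history_obs [IsProbabilityMeasure μ] [∀ k, IsProbabilityMeasure (P k)]
    [∀ k, IsProbabilityMeasure (Q k)] [∀ n, IsMarkovKernel (π n)]
    (hY : IsSampling μ P Q π Y) (n : ℕ) {f : Hist K 𝒳 n × Obs K 𝒳 → ℝ≥0∞} (hf : Measurable f) :
    ∫⁻ ω, f (history Y n ω, Y n ω) ∂μ
      = ∫⁻ ω, ∑ k, π n (history Y n ω) {k}
          * ∫⁻ x, f (history Y n ω, (k, x)) ∂((P k).prod (Q k)) ∂μ := by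
  have hH := measurable_history hY.measurable n
  have hJ : Measurable fun ω => (history Y n ω, (Y n ω).2) :=
    hH.prodMk (measurable_snd.comp (hY.measurable n))
  have hset : ∀ k, MeasurableSet {ω | (Y n ω).1 = k} := fun k =>
    (measurable_fst.comp (hY.measurable n)) (measurableSet_singleton k)
  have hfk : ∀ k, Measurable fun y : Hist K 𝒳 n × 𝒳 × 𝒳 => f (y.1, (k, y.2)) := fun k =>
    hf.comp (measurable_fst.prodMk (measurable_const.prodMk measurable_snd))
  have hm : ∀ k, Measurable fun ω => π n (history Y n ω) {k} := fun k =>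
    ((π n).measurable_coe (measurableSet_singleton k)).comp hH
  have hint : ∀ k, Measurable fun h : Hist K 𝒳 n => ∫⁻ x, f (h, (k, x)) ∂((P k).prod (Q k)) :=
    fun k => (hfk k).lintegral_prod_right'
  have hsplit : ∀ ω, f (history Y n ω, Y n ω)
      = ∑ k, Set.indicator {ω | (Y n ω).1 = k}
          (fun ω => f (history Y n ω, (k, (Y n ω).2))) ω := fun ω => by
    simp only [Set.indicator_apply, Set.mem_ofPred_eq]
    rw [Finset.sum_ite_eq]
    simp
  calc ∫⁻ ω, f (history Y n ω, Y n ω) ∂μ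
      = ∑ k, ∫⁻ ω in {ω | (Y n ω).1 = k}, f (history Y n ω, (k, (Y n ω).2)) ∂μ := by
        simp_rw [hsplit]
        rw [lintegral_finsetSum]
        · exact Finset.sum_congr rfl fun k _ => lintegral_indicator (hset k) _
        · exact fun k _ => ((hfk k).comp hJ).indicator (hset k)
    _ = ∑ k, ∫⁻ ω, π n (history Y n ω) {k}
          * ∫⁻ x, f (history Y n ω, (k, x)) ∂((P k).prod (Q k)) ∂μ := by
        refine Finset.sum_congr rfl fun k _ => ?_
        rw [← lintegral_map (hfk k) hJ, map_restrict_history_eq_prod hY,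
          lintegral_prod _ (hfk k).aemeasurable, lintegral_map (hint k) hH,
          lintegral_withDensity_eq_lintegral_mul _ (hm k) (g := fun ω =>
            ∫⁻ x, f (history Y n ω, (k, x)) ∂((P k).prod (Q k))) ((hint k).comp hH)]
        rfl
    _ = _ := by
        rw [lintegral_finsetSum]
        exact fun k _ => (hm k).mul ((hint k).comp hH)

/-- A product of conditionally sub-normalized factors has integral at most one. -/
theorem lintegral_prod_le_one [IsProbabilityMeasure μ] [∀ k, IsProbabilityMeasure (P k)]
    [∀ k, IsProbabilityMeasure (Q k)] [∀ n, IsMarkovKernel (π n)]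
    (hY : IsSampling μ P Q π Y) {f : (n : ℕ) → Hist K 𝒳 n → Obs K 𝒳 → ℝ≥0∞}
    (hf : ∀ n, Measurable fun y : Hist K 𝒳 n × Obs K 𝒳 => f n y.1 y.2)
    (hle : ∀ n h, ∑ k, π n h {k} * ∫⁻ x, f n h (k, x) ∂((P k).prod (Q k)) ≤ 1) (n : ℕ) :
    ∫⁻ ω, ∏ i ∈ Finset.range n, f i (history Y i ω) (Y i ω) ∂μ ≤ 1 := by
  induction n with
  | zero => simp
  | succ n ih =>
    have hΦ : Measurable fun h : Hist K 𝒳 n => ∏ i : Fin n, f i (h.before i) (h i) :=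
      Finset.measurable_fun_prod _ fun i _ =>
        (hf i).comp ((measurable_before i).prodMk (measurable_pi_apply i))
    have heq : ∀ ω, ∏ i ∈ Finset.range n, f i (history Y i ω) (Y i ω)
        = ∏ i : Fin n, f i ((history Y n ω).before i) (history Y n ω i) := fun ω =>
      (Fin.prod_univ_eq_prod_range (fun i => f i (history Y i ω) (Y i ω)) n).symm
    simp_rw [Finset.prod_range_succ]
    calc ∫⁻ ω, (∏ i ∈ Finset.range n, f i (history Y i ω) (Y i ω))
            * f n (history Y n ω) (Y n ω) ∂μ
        = ∫⁻ ω, (fun y : Hist K 𝒳 n × Obs K 𝒳 =>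
            (∏ i : Fin n, f i (y.1.before i) (y.1 i)) * f n y.1 y.2) (history Y n ω, Y n ω) ∂μ := by
          simp_rw [heq]
      _ = ∫⁻ ω, ∑ k, π n (history Y n ω) {k}
          * ∫⁻ x, (∏ i : Fin n, f i ((history Y n ω).before i) (history Y n ω i))
              * f n (history Y n ω) (k, x) ∂((P k).prod (Q k)) ∂μ :=
          lintegral_history_obs hY n ((hΦ.comp measurable_fst).mul (hf n))
      _ ≤ ∫⁻ ω, ∏ i ∈ Finset.range n, f i (history Y i ω) (Y i ω) ∂μ := by
          refine lintegral_mono fun ω => ?_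
          have hmk : ∀ k, Measurable fun x : 𝒳 × 𝒳 => f n (history Y n ω) (k, x) := fun k =>
            (hf n).comp (measurable_const.prodMk (measurable_const.prodMk measurable_id))
          simp_rw [heq, lintegral_const_mul _ (hmk _), mul_left_comm, ← Finset.mul_sum]
          exact mul_le_of_le_one_right' (hle n _)
      _ ≤ 1 := ih

/-- Exponential tail bound for sums with conditionally normalized exponential moments. -/
theorem measure_le_exp_neg [IsProbabilityMeasure μ] [∀ k, IsProbabilityMeasure (P k)]
    [∀ k, IsProbabilityMeasure (Q k)] [∀ n, IsMarkovKernel (π n)]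
    (hY : IsSampling μ P Q π Y) {φ : (n : ℕ) → Hist K 𝒳 n → Obs K 𝒳 → ℝ}
    (hφ : ∀ n, Measurable fun y : Hist K 𝒳 n × Obs K 𝒳 => φ n y.1 y.2)
    (hle : ∀ n h, ∑ k, π n h {k}
      * ∫⁻ x, ENNReal.ofReal (Real.exp (φ n h (k, x))) ∂((P k).prod (Q k)) ≤ 1) (n : ℕ) (x : ℝ) :
    μ {ω | x ≤ ∑ i ∈ Finset.range n, φ i (history Y i ω) (Y i ω)}
      ≤ ENNReal.ofReal (Real.exp (-x)) := by
  have hm : ∀ i, Measurable fun y : Hist K 𝒳 i × Obs K 𝒳 =>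
      ENNReal.ofReal (Real.exp (φ i y.1 y.2)) := fun i => (hφ i).exp.ennreal_ofReal
  have h1 := lintegral_prod_le_one hY (f := fun n h o => ENNReal.ofReal (Real.exp (φ n h o)))
    hm hle n
  have hmeas : Measurable fun ω => ∏ i ∈ Finset.range n,
      ENNReal.ofReal (Real.exp (φ i (history Y i ω) (Y i ω))) :=
    Finset.measurable_fun_prod _ fun i _ =>
      (hm i).comp ((measurable_history hY.measurable i).prodMk (hY.measurable i))
  have h2 := mul_meas_ge_le_lintegral (μ := μ) hmeas (ENNReal.ofReal (Real.exp x))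
  have hsub : {ω | x ≤ ∑ i ∈ Finset.range n, φ i (history Y i ω) (Y i ω)}
      ⊆ {ω | ENNReal.ofReal (Real.exp x) ≤ ∏ i ∈ Finset.range n,
        ENNReal.ofReal (Real.exp (φ i (history Y i ω) (Y i ω)))} := fun ω hω => by
    simp only [Set.mem_ofPred_eq] at hω ⊢
    rw [← ENNReal.ofReal_prod_of_nonneg fun _ _ => (Real.exp_pos _).le, ← Real.exp_sum]
    exact ENNReal.ofReal_le_ofReal (Real.exp_le_exp.2 hω)
  have h3 := (mul_le_mul_right (measure_mono hsub) (ENNReal.ofReal (Real.exp x))).trans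
    (h2.trans h1)
  rw [Real.exp_neg, ENNReal.ofReal_inv_of_pos (Real.exp_pos _), ← one_div]
  rwa [ENNReal.le_div_iff_mul_le (Or.inl (by simp [Real.exp_pos])) (Or.inl ENNReal.ofReal_ne_top),
    mul_comm]

theorem sum_prob_singleton (ν : Measure (Fin K)) [IsProbabilityMeasure ν] :
    ∑ k, ν {k} = 1 := by
  simp

theorem sum_mul_le_one (ν : Measure (Fin K)) [IsProbabilityMeasure ν] {c : Fin K → ℝ≥0∞}
    (hc : ∀ k, c k ≤ 1) : ∑ k, ν {k} * c k ≤ 1 := by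
  rw [← sum_prob_singleton ν]
  exact Finset.sum_le_sum fun k _ => mul_le_of_le_one_right' (hc k)

end ActiveTest

/-! ### The level of the test -/

namespace ActiveTest

variable {K : ℕ} {𝒳 Ω : Type*} [MeasurableSpace 𝒳] [MeasurableSpace Ω]
  {μ : Measure Ω} {P Q : Fin K → Measure 𝒳} {π : Selection K 𝒳} {Y : ℕ → Ω → Obs K 𝒳}
  {G : Set (𝒳 → ℝ)} {A : Prediction K 𝒳} {B : Betting K 𝒳}

/-! ### Payoffs -/

/-- The payoff of the slot that follows the history `h`. -/
def slotPayoff (A : Prediction K 𝒳) (n : ℕ) (h : Hist K 𝒳 n) (o : Obs K 𝒳) : ℝ :=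
  A o.1 n h o.2.1 - A o.1 n h o.2.2

theorem measurable_slotPayoff (hA : IsPrediction G A) (n : ℕ) :
    Measurable fun y : Hist K 𝒳 n × Obs K 𝒳 => slotPayoff A n y.1 y.2 := by
  have hsum : ∀ y : Hist K 𝒳 n × Obs K 𝒳, slotPayoff A n y.1 y.2
      = ∑ k, if y.2.1 = k then A k n y.1 y.2.2.1 - A k n y.1 y.2.2.2 else 0 := fun y => by
    rw [Finset.sum_ite_eq]
    simp [slotPayoff]
  simp_rw [hsum]
  refine Finset.measurable_fun_sum _ fun k _ => Measurable.ite ?_ ?_ measurable_const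
  · exact (measurable_fst.comp measurable_snd) (measurableSet_singleton k)
  · exact ((hA.measurable k n).comp (f := fun y : Hist K 𝒳 n × Obs K 𝒳 => (y.1, y.2.2.1))
      (by fun_prop)).sub ((hA.measurable k n).comp
        (f := fun y : Hist K 𝒳 n × Obs K 𝒳 => (y.1, y.2.2.2)) (by fun_prop))

theorem measurable_payoff (hA : IsPrediction G A) {n : ℕ} (i : Fin n) :
    Measurable fun h : Hist K 𝒳 n => payoff A h i :=
  (measurable_slotPayoff hA i).comp ((measurable_before i).prodMk (measurable_pi_apply i))

theorem abs_sub_le_one (hG : IsTestClass G) {g : 𝒳 → ℝ} (hg : g ∈ G) (x y : 𝒳) :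
    |g x - g y| ≤ 1 := by
  have h1 := (hG g hg).2 x
  have h2 := (hG g hg).2 y
  rw [abs_le]
  constructor <;> linarith [h1.1, h1.2, h2.1, h2.2]

theorem abs_slotPayoff_le (hG : IsTestClass G) (hA : IsPrediction G A) (n : ℕ)
    (h : Hist K 𝒳 n) (o : Obs K 𝒳) : |slotPayoff A n h o| ≤ 1 :=
  abs_sub_le_one hG (hA.mem _ _ _) _ _

theorem measurable_wealth (hA : IsPrediction G A) (hB : IsBetting B) (n : ℕ) :
    Measurable fun h : Hist K 𝒳 n => wealth A B h :=
  Finset.measurable_fun_prod _ fun i _ => measurable_const.add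
    (((hB.measurable i).comp (measurable_before i)).mul (measurable_payoff hA i))

theorem one_add_bet_mul_nonneg {b v : ℝ} (hb : b ∈ Set.Icc (-1 : ℝ) 1) (hv : |v| ≤ 1) :
    0 ≤ 1 + b * v := by
  have h1 : |b * v| ≤ 1 := by
    rw [abs_mul]
    exact mul_le_one₀ (abs_le.2 hb) (abs_nonneg _) hv
  linarith [(abs_le.1 h1).1]

omit [MeasurableSpace 𝒳] [MeasurableSpace Ω] in
theorem wealth_history (A : Prediction K 𝒳) (B : Betting K 𝒳) (n : ℕ) (ω : Ω) :
    wealth A B (history Y n ω) = ∏ i ∈ Finset.range n,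
      (1 + B i (history Y i ω) * slotPayoff A i (history Y i ω) (Y i ω)) :=
  Fin.prod_univ_eq_prod_range
    (fun i => 1 + B i (history Y i ω) * slotPayoff A i (history Y i ω) (Y i ω)) n

omit [MeasurableSpace Ω] in
theorem wealth_history_nonneg (hG : IsTestClass G) (hA : IsPrediction G A) (hB : IsBetting B)
    (n : ℕ) (ω : Ω) : 0 ≤ wealth A B (history Y n ω) := by
  rw [wealth_history]
  exact Finset.prod_nonneg fun i _ =>
    one_add_bet_mul_nonneg (hB.mem _ _) (abs_slotPayoff_le hG hA _ _ _)

theorem measurable_testDiff (hG : IsTestClass G) {g : 𝒳 → ℝ} (hg : g ∈ G) :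
    Measurable fun x : 𝒳 × 𝒳 => g x.1 - g x.2 :=
  ((hG g hg).1.comp measurable_fst).sub ((hG g hg).1.comp measurable_snd)

theorem integrable_testDiff (hG : IsTestClass G) {g : 𝒳 → ℝ} (hg : g ∈ G)
    (ν : Measure (𝒳 × 𝒳)) [IsFiniteMeasure ν] :
    Integrable (fun x : 𝒳 × 𝒳 => g x.1 - g x.2) ν :=
  Integrable.of_bound (measurable_testDiff hG hg).aestronglyMeasurable 1
    (ae_of_all _ fun x => abs_sub_le_one hG hg x.1 x.2)

theorem integral_testDiff_self (g : 𝒳 → ℝ) (R : Measure 𝒳) [IsProbabilityMeasure R] :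
    ∫ x, (g x.1 - g x.2) ∂(R.prod R) = 0 := by
  have h := integral_prod_swap (μ := R) (ν := R) (fun x : 𝒳 × 𝒳 => g x.1 - g x.2)
  have h2 : ∀ x : 𝒳 × 𝒳, g x.swap.1 - g x.swap.2 = -(g x.1 - g x.2) := fun x => by simp
  simp_rw [h2, integral_neg] at h
  linarith

/-! ### Ville's inequality for the wealth -/

/-- The wealth has reached `1 / α` in the course of the history. -/
def Crossed (A : Prediction K 𝒳) (B : Betting K 𝒳) (α : ℝ) {n : ℕ} (h : Hist K 𝒳 n) : Prop :=
  ∃ m : Fin (n + 1), 1 / α ≤ wealth A B fun j : Fin m =>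
    h (Fin.castLE (Nat.lt_succ_iff.1 m.isLt) j)

theorem measurableSet_crossed (hA : IsPrediction G A) (hB : IsBetting B) (α : ℝ) (n : ℕ) :
    MeasurableSet {h : Hist K 𝒳 n | Crossed A B α h} := by
  have : {h : Hist K 𝒳 n | Crossed A B α h} = ⋃ m : Fin (n + 1),
      {h | 1 / α ≤ wealth A B fun j : Fin m => h (Fin.castLE (Nat.lt_succ_iff.1 m.isLt) j)} := by
    ext h
    simp [Crossed]
  rw [this]
  refine MeasurableSet.iUnion fun m => measurableSet_le measurable_const ?_
  exact (measurable_wealth hA hB m).comp (measurable_pi_lambda _ fun _ => measurable_pi_apply _)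

omit [MeasurableSpace 𝒳] [MeasurableSpace Ω] in
theorem crossed_history_iff {α : ℝ} {n : ℕ} {ω : Ω} :
    Crossed A B α (history Y n ω) ↔ ∃ m ≤ n, 1 / α ≤ wealth A B (history Y m ω) :=
  ⟨fun ⟨m, hm⟩ => ⟨m, Nat.lt_succ_iff.1 m.isLt, hm⟩,
    fun ⟨m, hmn, hm⟩ => ⟨⟨m, Nat.lt_succ_iff.2 hmn⟩, hm⟩⟩

open Classical in
/-- The factor by which the stopped wealth grows in the slot after the history `h`. -/
noncomputable def stoppedFactor (A : Prediction K 𝒳) (B : Betting K 𝒳) (α : ℝ) (n : ℕ)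
    (h : Hist K 𝒳 n) (o : Obs K 𝒳) : ℝ≥0∞ :=
  if Crossed A B α h then 1 else ENNReal.ofReal (1 + B n h * slotPayoff A n h o)

-- The product stops changing after the first crossing and so stays at or above `1 / α`; its value
-- at time `n` therefore remembers every earlier crossing.
omit [MeasurableSpace Ω] in
theorem prod_stoppedFactor (hG : IsTestClass G) (hA : IsPrediction G A) (hB : IsBetting B)
    (α : ℝ) (n : ℕ) (ω : Ω) :
    (¬ Crossed A B α (history Y n ω) →
      ∏ i ∈ Finset.range n, stoppedFactor A B α i (history Y i ω) (Y i ω)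
        = ENNReal.ofReal (wealth A B (history Y n ω))) ∧
    (Crossed A B α (history Y n ω) → ENNReal.ofReal (1 / α)
      ≤ ∏ i ∈ Finset.range n, stoppedFactor A B α i (history Y i ω) (Y i ω)) := by
  induction n with
  | zero =>
    simp only [crossed_history_iff]
    refine ⟨fun _ => by simp [wealth], ?_⟩
    rintro ⟨m, hm, h⟩
    obtain rfl : m = 0 := by omega
    have : wealth A B (history Y 0 ω) = 1 := by simp [wealth]
    rw [this] at h
    simpa using h
  | succ n ih =>
    rw [Finset.prod_range_succ]
    by_cases hc : Crossed A B α (history Y n ω)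
    · have hc' : Crossed A B α (history Y (n + 1) ω) := by
        rw [crossed_history_iff] at hc ⊢
        obtain ⟨m, hm, h⟩ := hc
        exact ⟨m, by omega, h⟩
      refine ⟨fun h => absurd hc' h, fun _ => ?_⟩
      rw [stoppedFactor, if_pos hc, mul_one]
      exact ih.2 hc
    · have heq : (∏ i ∈ Finset.range n, stoppedFactor A B α i (history Y i ω) (Y i ω))
          * stoppedFactor A B α n (history Y n ω) (Y n ω)
          = ENNReal.ofReal (wealth A B (history Y (n + 1) ω)) := by
        rw [ih.1 hc, stoppedFactor, if_neg hc,
          ← ENNReal.ofReal_mul (wealth_history_nonneg hG hA hB n ω), wealth_history A B (n + 1),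
          Finset.prod_range_succ, ← wealth_history]
      refine ⟨fun _ => heq, fun h => ?_⟩
      rw [heq]
      rw [crossed_history_iff] at h hc
      obtain ⟨m, hm, h⟩ := h
      rcases Nat.lt_or_ge n m with hlt | hle
      · obtain rfl : m = n + 1 := by omega
        exact ENNReal.ofReal_le_ofReal h
      · exact absurd ⟨m, hle, h⟩ hc

/-- Each stopped factor has conditional mean exactly 1, because swapping the two samples changes the
sign of the payoff and preserves their law. Markov's inequality for the stopped product finishes. -/
theorem measure_crossed_le [IsProbabilityMeasure μ] [∀ k, IsProbabilityMeasure (P k)]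
    [∀ k, IsProbabilityMeasure (Q k)] [∀ n, IsMarkovKernel (π n)] (hG : IsTestClass G)
    (hA : IsPrediction G A) (hB : IsBetting B) (hY : IsSampling μ P Q π Y) {α : ℝ} (hα : 0 < α)
    (hPQ : ∀ k, P k = Q k) (n : ℕ) :
    μ {ω | Crossed A B α (history Y n ω)} ≤ ENNReal.ofReal α := by
  have hm : ∀ n, Measurable fun y : Hist K 𝒳 n × Obs K 𝒳 => stoppedFactor A B α n y.1 y.2 :=
    fun n => Measurable.ite (measurable_fst (measurableSet_crossed hA hB α n)) measurable_const
      (measurable_const.add (((hB.measurable n).comp measurable_fst).mul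
        (measurable_slotPayoff hA n))).ennreal_ofReal
  have hle : ∀ n h, ∑ k, π n h {k}
      * ∫⁻ x, stoppedFactor A B α n h (k, x) ∂((P k).prod (Q k)) ≤ 1 := fun n h => by
    refine sum_mul_le_one _ fun k => ?_
    by_cases hc : Crossed A B α h
    · simp [stoppedFactor, hc]
    · simp only [stoppedFactor, hc, if_false]
      have hint : Integrable (fun x => 1 + B n h * slotPayoff A n h (k, x)) ((P k).prod (Q k)) :=
        (integrable_const _).add ((integrable_testDiff hG (hA.mem k n h) _).const_mul _)
      rw [← ofReal_integral_eq_lintegral_ofReal hint (ae_of_all _ fun x =>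
        one_add_bet_mul_nonneg (hB.mem _ _) (abs_slotPayoff_le hG hA _ _ _)), integral_add
          (integrable_const _) (g := fun x => B n h * slotPayoff A n h (k, x))
          ((integrable_testDiff hG (hA.mem k n h) _).const_mul _), integral_const_mul]
      have h0 : ∫ x, slotPayoff A n h (k, x) ∂((P k).prod (Q k)) = 0 := by
        rw [← hPQ k]
        exact integral_testDiff_self (A k n h) (P k)
      simp [h0]
  have h1 := lintegral_prod_le_one hY hm hle n
  have hmeas : Measurable fun ω => ∏ i ∈ Finset.range n,
      stoppedFactor A B α i (history Y i ω) (Y i ω) :=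
    Finset.measurable_fun_prod _ fun i _ =>
      (hm i).comp ((measurable_history hY.measurable i).prodMk (hY.measurable i))
  have h2 := mul_meas_ge_le_lintegral (μ := μ) hmeas (ENNReal.ofReal (1 / α))
  have hsub : {ω | Crossed A B α (history Y n ω)} ⊆ {ω | ENNReal.ofReal (1 / α)
      ≤ ∏ i ∈ Finset.range n, stoppedFactor A B α i (history Y i ω) (Y i ω)} :=
    fun ω hω => (prod_stoppedFactor hG hA hB α n ω).2 hω
  have h3 := (mul_le_mul_right (measure_mono hsub) (ENNReal.ofReal (1 / α))).trans (h2.trans h1)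
  rw [one_div, ENNReal.ofReal_inv_of_pos hα] at h3
  have hne : ENNReal.ofReal α ≠ 0 := by simpa using hα
  calc μ {ω | Crossed A B α (history Y n ω)}
      = ENNReal.ofReal α * ((ENNReal.ofReal α)⁻¹ * μ {ω | Crossed A B α (history Y n ω)}) := by
        rw [← mul_assoc, ENNReal.mul_inv_cancel hne ENNReal.ofReal_ne_top, one_mul]
    _ ≤ ENNReal.ofReal α := mul_le_of_le_one_right' h3

omit [MeasurableSpace 𝒳] [MeasurableSpace Ω] in
theorem stopTime_le_of_wealth {α : ℝ} {ω : Ω} {t : ℕ} (ht : 1 ≤ t)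
    (h : 1 / α ≤ wealth A B (history Y t ω)) : stopTime A B α Y ω ≤ t :=
  iInf₂_le t ⟨ht, h⟩

theorem measure_stopTime_lt_top_le [IsProbabilityMeasure μ] [∀ k, IsProbabilityMeasure (P k)]
    [∀ k, IsProbabilityMeasure (Q k)] [∀ n, IsMarkovKernel (π n)] (hG : IsTestClass G)
    (hA : IsPrediction G A) (hB : IsBetting B) (hY : IsSampling μ P Q π Y) {α : ℝ} (hα : 0 < α)
    (hPQ : ∀ k, P k = Q k) :
    μ {ω | stopTime A B α Y ω < ⊤} ≤ ENNReal.ofReal α := by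
  -- `Crossed` also admits time 0, while the stopping time starts at 1; an inclusion suffices.
  have hsub : {ω | stopTime A B α Y ω < ⊤} ⊆ ⋃ n, {ω | Crossed A B α (history Y n ω)} := by
    intro ω hω
    simp only [stopTime, Set.mem_ofPred_eq, iInf_lt_iff] at hω
    obtain ⟨t, ⟨-, ht⟩, -⟩ := hω
    exact Set.mem_iUnion.2 ⟨t, crossed_history_iff.2 ⟨t, le_rfl, ht⟩⟩
  refine (measure_mono hsub).trans ?_
  rw [Monotone.measure_iUnion]
  · exact iSup_le fun n => measure_crossed_le hG hA hB hY hα hPQ n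
  · intro m n hmn ω hω
    obtain ⟨i, hi, h⟩ := crossed_history_iff.1 hω
    exact crossed_history_iff.2 ⟨i, hi.trans hmn, h⟩

end ActiveTest

/-! ### Pathwise wealth of the online Newton step -/

namespace ActiveTest

/-! ### The online Newton step -/

theorem log_three_lt : Real.log 3 < 1.2 := by
  have h : (3 : ℝ) < Real.exp 1.2 := by
    have := Real.exp_one_gt_d9
    have h2 := Real.add_one_le_exp (0.2 : ℝ)
    have h3 : Real.exp 1.2 = Real.exp 1 * Real.exp 0.2 := by
      rw [← Real.exp_add]; norm_num
    rw [h3]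
    nlinarith
  exact (Real.log_lt_iff_lt_exp (by norm_num)).2 h

theorem one_lt_log_three : 1 < Real.log 3 := by
  rw [Real.lt_log_iff_exp_lt (by norm_num)]
  linarith [Real.exp_one_lt_d9]

/-- The curvature of the logarithm on `(-1, 2]` that underlies the step size. -/
theorem log_one_add_le {y : ℝ} (h1 : -1 < y) (h2 : y ≤ 2) :
    Real.log (1 + y) ≤ y - (2 - Real.log 3) / 4 * y ^ 2 := by
  set b := (2 - Real.log 3) / 4 with hb
  have hb1 : b < 1 / 4 := by rw [hb]; linarith [one_lt_log_three]
  have hb2 : 1 / 5 ≤ b := by rw [hb]; linarith [log_three_lt]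
  let f : ℝ → ℝ := fun y => y - b * y ^ 2 - Real.log (1 + y)
  have hd : ∀ y : ℝ, -1 < y → HasDerivAt f (y * (1 - 2 * b * (1 + y)) / (1 + y)) y := by
    intro y hy
    have hne : (1 + y) ≠ 0 := by linarith
    have := ((hasDerivAt_id y).sub ((hasDerivAt_pow 2 y).const_mul b)).sub
      (((hasDerivAt_id y).const_add 1).log hne)
    refine this.congr_deriv ?_
    simp only [id]
    field_simp
    ring
  have hcont : ContinuousOn f (Set.Ioi (-1)) := fun y hy =>
    (hd y hy).continuousAt.continuousWithinAt
  have hf0 : f 0 = 0 := by simp [f]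
  have hf2 : f 2 = 0 := by
    have : (1 + 2 : ℝ) = 3 := by norm_num
    simp only [f, this, hb]
    ring
  suffices h : 0 ≤ f y by
    simp only [f] at h
    linarith
  -- The critical points of `f` are 0 and `p`, and `f` vanishes at 0 and, by the choice of `b`, at
  -- 2. It decreases to 0 on `(-1, 0]`, increases on `[0, p]` and decreases to 0 on `[p, 2]`, so it
  -- is nonnegative throughout.
  set p := 1 / (2 * b) - 1 with hp
  have hbp : 2 * b * (1 + p) = 1 := by
    rw [hp]; field_simp; ring
  have hp1 : 0 ≤ p := by
    by_contra hneg
    nlinarith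
  have hp2 : p ≤ 2 := by
    by_contra hneg
    nlinarith
  rcases le_total y 0 with hy | hy
  · rw [← hf0]
    refine antitoneOn_of_deriv_nonpos (convex_Ioc (-1 : ℝ) 0)
      (hcont.mono fun x hx => hx.1) ?_ ?_ ⟨h1, hy⟩ ⟨by norm_num, le_rfl⟩ hy
    · intro x hx
      rw [interior_Ioc] at hx
      exact (hd x hx.1).differentiableAt.differentiableWithinAt
    · intro x hx
      rw [interior_Ioc] at hx
      rw [(hd x hx.1).deriv]
      refine div_nonpos_of_nonpos_of_nonneg ?_ (by linarith [hx.1])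
      refine mul_nonpos_of_nonpos_of_nonneg hx.2.le ?_
      nlinarith [hx.1, hx.2]
  rcases le_total y p with hyp | hyp
  · rw [← hf0]
    refine monotoneOn_of_deriv_nonneg (convex_Icc (0 : ℝ) p)
      (hcont.mono fun x hx => by simpa using lt_of_lt_of_le (by norm_num) hx.1) ?_ ?_
      ⟨le_rfl, hp1⟩ ⟨hy, hyp⟩ hy
    · intro x hx
      rw [interior_Icc] at hx
      exact (hd x (by linarith [hx.1])).differentiableAt.differentiableWithinAt
    · intro x hx
      rw [interior_Icc] at hx
      rw [(hd x (by linarith [hx.1])).deriv]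
      refine div_nonneg (mul_nonneg hx.1.le ?_) (by linarith [hx.1])
      nlinarith [hx.1, hx.2]
  · rw [← hf2]
    refine antitoneOn_of_deriv_nonpos (convex_Icc p 2)
      (hcont.mono fun x hx => by
        have := hx.1
        simp only [Set.mem_Ioi]
        linarith) ?_ ?_
      ⟨hyp, h2⟩ ⟨hp2, le_rfl⟩ h2
    · intro x hx
      rw [interior_Icc] at hx
      exact (hd x (by linarith [hx.1])).differentiableAt.differentiableWithinAt
    · intro x hx
      rw [interior_Icc] at hx
      rw [(hd x (by linarith [hx.1])).deriv]
      refine div_nonpos_of_nonpos_of_nonneg ?_ (by linarith [hx.1])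
      refine mul_nonpos_of_nonneg_of_nonpos (by linarith [hx.1]) ?_
      nlinarith [hx.1, hx.2]

theorem sub_sq_le_log_one_add {x : ℝ} (hx : |x| ≤ 1 / 2) : x - x ^ 2 ≤ Real.log (1 + x) := by
  obtain ⟨h1, h2⟩ := abs_le.1 hx
  have hpos : 0 < 1 + x := by linarith
  rcases le_total 0 x with h0 | h0
  · refine le_trans ?_ (Real.le_log_one_add_of_nonneg h0)
    rw [le_div_iff₀ (by linarith)]
    nlinarith [pow_nonneg h0 3, sq_nonneg x]
  -- For `x ≤ 0` the claim is `1 ≤ (1 + x) exp (x² - x)`; here `x² - x ≥ 0`, so the quadratic lower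
  -- bound of the exponential applies.
  · rw [Real.le_log_iff_exp_le hpos]
    have hq := Real.quadratic_le_exp_of_nonneg (x := x ^ 2 - x) (by nlinarith)
    have hprod : Real.exp (x - x ^ 2) * Real.exp (x ^ 2 - x) = 1 := by
      rw [← Real.exp_add]; simp
    have hbig : 1 ≤ (1 + x) * (1 + (x ^ 2 - x) + (x ^ 2 - x) ^ 2 / 2) := by
      have hid : (1 + x) * (1 + (x ^ 2 - x) + (x ^ 2 - x) ^ 2 / 2)
          = 1 + x ^ 2 * ((1 + x - x ^ 2 + x ^ 3) / 2) := by ring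
      have : 0 ≤ 1 + x - x ^ 2 + x ^ 3 := by nlinarith [sq_nonneg x]
      rw [hid]
      nlinarith [mul_nonneg (sq_nonneg x) (by linarith : 0 ≤ (1 + x - x ^ 2 + x ^ 3) / 2)]
    by_contra hneg
    push Not at hneg
    nlinarith [Real.exp_pos (x - x ^ 2), Real.exp_pos (x ^ 2 - x)]

theorem onsState_fst_mem (v : ℕ → ℝ) (n : ℕ) :
    (onsState v n).1 ∈ Set.Icc (-(1 / 2) : ℝ) (1 / 2) := by
  cases n with
  | zero => simp [onsState]
  | succ n =>
    simp only [onsState]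
    exact ⟨le_min (by norm_num) (le_max_left _ _), min_le_left _ _⟩

theorem onsState_congr {v w : ℕ → ℝ} {n : ℕ} (h : ∀ i < n, v i = w i) :
    onsState v n = onsState w n := by
  induction n with
  | zero => rfl
  | succ n ih =>
    have := ih fun i hi => h i (by omega)
    simp only [onsState, this, h n (by omega)]

/-- Projection onto an interval does not increase the distance to a point of that interval. -/
theorem sq_clip_sub_le {x u : ℝ} (hu : |u| ≤ 1 / 2) :
    (min (1 / 2) (max (-(1 / 2)) x) - u) ^ 2 ≤ (x - u) ^ 2 := by
  obtain ⟨h1, h2⟩ := abs_le.1 hu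
  rcases min_cases (1 / 2 : ℝ) (max (-(1 / 2)) x) with ⟨h, h'⟩ | ⟨h, h'⟩ <;>
  rcases max_cases (-(1 / 2) : ℝ) x with ⟨g, g'⟩ | ⟨g, g'⟩ <;> rw [g] at h h' <;>
  rw [g, h] <;> nlinarith

/-- The regret of the online Newton step. -/
theorem ons_regret {v : ℕ → ℝ} (hv : ∀ i, |v i| ≤ 1) {u : ℝ} (hu : |u| ≤ 1 / 2) (n : ℕ) :
    ∑ i ∈ Finset.range n, Real.log (1 + u * v i)
      ≤ ∑ i ∈ Finset.range n, Real.log (1 + (onsState v i).1 * v i)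
        + 1 + 2 * Real.log (1 + 4 * n) := by
  set γ := (2 - Real.log 3) / 2 with hγ
  have hγ1 : γ < 1 / 2 := by rw [hγ]; linarith [one_lt_log_three]
  have hγ2 : 2 / 5 ≤ γ := by rw [hγ]; linarith [log_three_lt]
  have hstep : (2 : ℝ) / (2 - Real.log 3) = 1 / γ := by
    rw [hγ]; field_simp
  obtain ⟨hu1, hu2⟩ := abs_le.1 hu
  -- Potential argument: the regret so far plus the weighted squared distance to `u` is controlled
  -- by `log a`. The bound `a ≤ 1 + 4n` holds because `|z| ≤ 2`.
  have key : ∀ n : ℕ, 1 ≤ (onsState v n).2 ∧ (onsState v n).2 ≤ 1 + 4 * n ∧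
      ∑ i ∈ Finset.range n, (Real.log (1 + u * v i) - Real.log (1 + (onsState v i).1 * v i))
        + γ / 2 * (onsState v n).2 * ((onsState v n).1 - u) ^ 2
      ≤ γ / 2 * u ^ 2 + 1 / (2 * γ) * Real.log (onsState v n).2 := by
    intro n
    induction n with
    | zero => simp [onsState]
    | succ n ih =>
      obtain ⟨ha1, ha2, hS⟩ := ih
      obtain ⟨hl1, hl2⟩ := onsState_fst_mem v n
      obtain ⟨hv1, hv2⟩ := abs_le.1 (hv n)
      rw [Finset.sum_range_succ]
      set l := (onsState v n).1 with hl
      set a := (onsState v n).2 with ha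
      set z := v n / (1 + v n * l) with hz
      have hfst : (onsState v (n + 1)).1
          = min (1 / 2) (max (-(1 / 2)) (l + 1 / γ * (z / (a + z ^ 2)))) := by
        simp only [onsState, hstep]
        rfl
      have hsnd : (onsState v (n + 1)).2 = a + z ^ 2 := rfl
      rw [hsnd, hfst]
      set a' := a + z ^ 2 with ha'
      have hden : 1 / 2 ≤ 1 + v n * l := by nlinarith
      have hz4 : z ^ 2 ≤ 4 := by
        rw [hz, div_pow, div_le_iff₀ (by positivity)]
        nlinarith
      have ha'1 : 1 ≤ a' := by nlinarith [sq_nonneg z]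
      refine ⟨ha'1, by push_cast; linarith, ?_⟩
      have hcurv : Real.log (1 + u * v n) - Real.log (1 + l * v n)
          ≤ z * (u - l) - γ / 2 * (z * (u - l)) ^ 2 := by
        -- Both bets lie in `[-1/2, 1/2]`, so this ratio lies in `(0, 3]`. That is the range covered
        -- by `log_one_add_le` and the origin of `log 3` in the step size.
        have hy : 1 + z * (u - l) = (1 + u * v n) / (1 + l * v n) := by
          rw [hz]
          have : 1 + v n * l ≠ 0 := by linarith
          have : 1 + l * v n ≠ 0 := by linarith
          field_simp
          ring
        have hnum1 : 1 / 2 ≤ 1 + u * v n := by nlinarith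
        have hnum2 : 1 + u * v n ≤ 3 / 2 := by nlinarith
        have hden' : 1 / 2 ≤ 1 + l * v n := by linarith
        rw [← Real.log_div (by linarith) (by linarith), ← hy]
        have h := log_one_add_le (y := z * (u - l))
          (by
            have : 0 < (1 + u * v n) / (1 + l * v n) := by positivity
            linarith)
          (by
            have : (1 + u * v n) / (1 + l * v n) ≤ 3 := by
              rw [div_le_iff₀ (by linarith)]; linarith
            linarith)
        have : (2 - Real.log 3) / 4 = γ / 2 := by rw [hγ]; ring
        rwa [this] at h
      have hproj := sq_clip_sub_le (x := l + 1 / γ * (z / a')) hu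
      have hexp : γ / 2 * a' * (l + 1 / γ * (z / a') - u) ^ 2
          = γ / 2 * a' * (l - u) ^ 2 + z * (l - u) + 1 / (2 * γ) * (z ^ 2 / a') := by
        have : a' ≠ 0 := by positivity
        have : γ ≠ 0 := by positivity
        field_simp
        ring
      -- The gradient terms telescope into `log a`, whence the logarithmic regret.
      have hlog : z ^ 2 / a' ≤ Real.log a' - Real.log a := by
        rw [← Real.log_div (by positivity) (by positivity)]
        have h := Real.one_sub_inv_le_log_of_pos (x := a' / a) (by positivity)
        rw [inv_div] at h
        have : 1 - a / a' = z ^ 2 / a' := by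
          rw [eq_div_iff (by positivity), sub_mul, div_mul_cancel₀ _ (by positivity)]
          rw [ha']; ring
        linarith
      have h1 := mul_le_mul_of_nonneg_left hproj (by positivity : 0 ≤ γ / 2 * a')
      have h2 := mul_le_mul_of_nonneg_left hlog (by positivity : 0 ≤ 1 / (2 * γ))
      have h3 : γ / 2 * a' * (l - u) ^ 2
          = γ / 2 * a * (l - u) ^ 2 + γ / 2 * (z * (u - l)) ^ 2 := by
        rw [ha']; ring
      linarith
  obtain ⟨h1, h2, h3⟩ := key n
  rw [Finset.sum_sub_distrib] at h3
  have h4 : 0 ≤ γ / 2 * (onsState v n).2 * ((onsState v n).1 - u) ^ 2 := by positivity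
  have h5 : γ / 2 * u ^ 2 ≤ 1 := by nlinarith
  have h6 : Real.log (onsState v n).2 ≤ Real.log (1 + 4 * n) := Real.log_le_log (by linarith) h2
  have h7 : 0 ≤ Real.log (onsState v n).2 := Real.log_nonneg h1
  have h8 : 1 / (2 * γ) ≤ 2 := by
    rw [div_le_iff₀ (by positivity)]; linarith
  nlinarith

/-- A lower bound for the logarithmic wealth of the online Newton step bets. -/
theorem ons_log_wealth_ge {v : ℕ → ℝ} (hv : ∀ i, |v i| ≤ 1) {u : ℝ} (hu : |u| ≤ 1 / 2) (n : ℕ) :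
    u * ∑ i ∈ Finset.range n, v i - u ^ 2 * ∑ i ∈ Finset.range n, v i ^ 2
        - 1 - 2 * Real.log (1 + 4 * n)
      ≤ ∑ i ∈ Finset.range n, Real.log (1 + (onsState v i).1 * v i) := by
  have h1 := ons_regret hv hu n
  have h2 : ∑ i ∈ Finset.range n, (u * v i - (u * v i) ^ 2)
      ≤ ∑ i ∈ Finset.range n, Real.log (1 + u * v i) :=
    Finset.sum_le_sum fun i _ => sub_sq_le_log_one_add (by
      rw [abs_mul]
      nlinarith [hv i, abs_nonneg (v i), abs_nonneg u])
  rw [Finset.sum_sub_distrib, ← Finset.mul_sum] at h2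
  simp_rw [mul_pow] at h2
  rw [← Finset.mul_sum] at h2
  linarith

section

variable {K : ℕ} {𝒳 Ω : Type*} [MeasurableSpace 𝒳] {G : Set (𝒳 → ℝ)} {A : Prediction K 𝒳}
  {Y : ℕ → Ω → Obs K 𝒳}

-- The bets are computed from payoffs padded with zeros, but the state after `n` steps reads only
-- the first `n` of them.
omit [MeasurableSpace 𝒳] in
theorem onsBetting_history (A : Prediction K 𝒳) (Y : ℕ → Ω → Obs K 𝒳) (n : ℕ) (ω : Ω) :
    onsBetting A n (history Y n ω)
      = (onsState (fun i => slotPayoff A i (history Y i ω) (Y i ω)) n).1 := by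
  rw [onsBetting]
  refine congrArg Prod.fst (onsState_congr fun i hi => ?_)
  simp only [hi, dif_pos]
  rfl

theorem log_wealth_ons_ge (hG : IsTestClass G) (hA : IsPrediction G A) {u : ℝ}
    (hu : |u| ≤ 1 / 2) (n : ℕ) (ω : Ω) :
    u * ∑ i ∈ Finset.range n, slotPayoff A i (history Y i ω) (Y i ω)
        - u ^ 2 * ∑ i ∈ Finset.range n, slotPayoff A i (history Y i ω) (Y i ω) ^ 2
        - 1 - 2 * Real.log (1 + 4 * n)
      ≤ Real.log (wealth A (onsBetting A) (history Y n ω)) := by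
  have hv : ∀ i, |slotPayoff A i (history Y i ω) (Y i ω)| ≤ 1 := fun i =>
    abs_slotPayoff_le hG hA _ _ _
  rw [wealth_history, Real.log_prod]
  · simp_rw [onsBetting_history]
    exact ons_log_wealth_ge hv hu n
  · intro i _
    rw [onsBetting_history]
    have h1 := onsState_fst_mem (fun i => slotPayoff A i (history Y i ω) (Y i ω)) i
    have h2 := abs_le.1 (hv i)
    have : 0 < 1 + (onsState (fun i => slotPayoff A i (history Y i ω) (Y i ω)) i).1
        * slotPayoff A i (history Y i ω) (Y i ω) := by nlinarith [h1.1, h1.2, h2.1, h2.2]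
    exact this.ne'

/-- The wealth has reached `1 / α` when a lower bound of its logarithm has. -/
theorem le_wealth_ons (hG : IsTestClass G) (hA : IsPrediction G A) {u α : ℝ} (hα : 0 < α)
    (hα1 : α < 1) (hu : |u| ≤ 1 / 2) (n : ℕ) (ω : Ω)
    (h : Real.log (1 / α) ≤ u * ∑ i ∈ Finset.range n, slotPayoff A i (history Y i ω) (Y i ω)
        - u ^ 2 * ∑ i ∈ Finset.range n, slotPayoff A i (history Y i ω) (Y i ω) ^ 2
        - 1 - 2 * Real.log (1 + 4 * n)) :
    1 / α ≤ wealth A (onsBetting A) (history Y n ω) := by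
  have hpos : 0 < wealth A (onsBetting A) (history Y n ω) := by
    rw [wealth_history]
    refine Finset.prod_pos fun i _ => ?_
    rw [onsBetting_history]
    have h1 := onsState_fst_mem (fun i => slotPayoff A i (history Y i ω) (Y i ω)) i
    have h2 := abs_le.1 (abs_slotPayoff_le hG hA i (history Y i ω) (Y i ω))
    nlinarith [h1.1, h1.2, h2.1, h2.2]
  exact (Real.log_le_log_iff (by positivity) hpos).1 (h.trans (log_wealth_ons_ge hG hA hu n ω))

end

end ActiveTest

/-! ### Distances, variances and tail bounds for each source -/

namespace ActiveTest

variable {K : ℕ} {𝒳 Ω : Type*} [MeasurableSpace 𝒳] [MeasurableSpace Ω]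
  {μ : Measure Ω} {P Q : Fin K → Measure 𝒳} {π : Selection K 𝒳} {Y : ℕ → Ω → Obs K 𝒳}
  {G : Set (𝒳 → ℝ)} {A : Prediction K 𝒳}

/-! ### Distances and variances -/

theorem abs_integral_testDiff_le (hG : IsTestClass G) {g : 𝒳 → ℝ} (hg : g ∈ G)
    (ν : Measure (𝒳 × 𝒳)) [IsProbabilityMeasure ν] :
    |∫ x, (g x.1 - g x.2) ∂ν| ≤ 1 := by
  have h := norm_integral_le_of_norm_le_const (μ := ν) (f := fun x : 𝒳 × 𝒳 => g x.1 - g x.2)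
    (C := 1) (ae_of_all _ fun x => abs_sub_le_one hG hg x.1 x.2)
  simpa using h

theorem integral_le_dist (hG : IsTestClass G) {g : 𝒳 → ℝ} (hg : g ∈ G)
    (R S : Measure 𝒳) [IsProbabilityMeasure R] [IsProbabilityMeasure S] :
    ∫ x, (g x.1 - g x.2) ∂(R.prod S) ≤ dist G R S := by
  refine le_csSup ⟨1, ?_⟩ ⟨g, hg, rfl⟩
  rintro _ ⟨f, hf, rfl⟩
  exact (abs_le.1 (abs_integral_testDiff_le hG hf _)).2

theorem abs_integral_le_dist (hG : IsTestClass G) (hs : IsSymmetricClass G) {g : 𝒳 → ℝ}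
    (hg : g ∈ G) (R S : Measure 𝒳) [IsProbabilityMeasure R] [IsProbabilityMeasure S] :
    |∫ x, (g x.1 - g x.2) ∂(R.prod S)| ≤ dist G R S := by
  refine abs_le'.2 ⟨integral_le_dist hG hg R S, ?_⟩
  have h := integral_le_dist hG (hs g hg) R S
  have heq : ∀ x : 𝒳 × 𝒳, (-g) x.1 - (-g) x.2 = -(g x.1 - g x.2) := fun x => by
    simp only [Pi.neg_apply]; ring
  simp_rw [heq, integral_neg] at h
  exact h

theorem dist_nonneg (hG : IsTestClass G) (hs : IsSymmetricClass G)
    (R S : Measure 𝒳) [IsProbabilityMeasure R] [IsProbabilityMeasure S] : 0 ≤ dist G R S := by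
  rcases G.eq_empty_or_nonempty with rfl | ⟨g, hg⟩
  -- For the empty class the real supremum takes its default value 0.
  · simp [dist]
  · exact (abs_nonneg _).trans (abs_integral_le_dist hG hs hg R S)

theorem dist_le_one (hG : IsTestClass G)
    (R S : Measure 𝒳) [IsProbabilityMeasure R] [IsProbabilityMeasure S] : dist G R S ≤ 1 := by
  refine Real.sSup_le ?_ zero_le_one
  rintro _ ⟨f, hf, rfl⟩
  exact (abs_le.1 (abs_integral_testDiff_le hG hf _)).2

theorem exists_integral_gt_dist_sub {R S : Measure 𝒳} (hne : G.Nonempty) {η : ℝ} (hη : 0 < η) :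
    ∃ g ∈ G, dist G R S - η < ∫ x, (g x.1 - g x.2) ∂(R.prod S) := by
  obtain ⟨_, ⟨g, hg, rfl⟩, h⟩ := exists_lt_of_lt_csSup
    (hne.image fun g : 𝒳 → ℝ => ∫ x, (g x.1 - g x.2) ∂(R.prod S))
    (show dist G R S - η < dist G R S by linarith)
  exact ⟨g, hg, h⟩

theorem variance_testDiff_le_one (hG : IsTestClass G) {g : 𝒳 → ℝ} (hg : g ∈ G)
    (ν : Measure (𝒳 × 𝒳)) [IsProbabilityMeasure ν] :
    variance (fun x : 𝒳 × 𝒳 => g x.1 - g x.2) ν ≤ 1 := by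
  have h := variance_le_sq_of_bounded (μ := ν) (a := -1) (b := 1)
    (X := fun x : 𝒳 × 𝒳 => g x.1 - g x.2)
    (ae_of_all _ fun x => abs_le.1 (abs_sub_le_one hG hg x.1 x.2))
    (measurable_testDiff hG hg).aemeasurable
  norm_num at h
  exact h

theorem variance_le_stdev_sq (hG : IsTestClass G) {g : 𝒳 → ℝ} (hg : g ∈ G)
    (R S : Measure 𝒳) [IsProbabilityMeasure R] [IsProbabilityMeasure S] :
    variance (fun x : 𝒳 × 𝒳 => g x.1 - g x.2) (R.prod S) ≤ stdev G R S ^ 2 := by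
  have h : variance (fun x : 𝒳 × 𝒳 => g x.1 - g x.2) (R.prod S)
      ≤ sSup ((fun g : 𝒳 → ℝ =>
        variance (fun x : 𝒳 × 𝒳 => g x.1 - g x.2) (R.prod S)) '' G) := by
    refine le_csSup ⟨1, ?_⟩ ⟨g, hg, rfl⟩
    rintro _ ⟨f, hf, rfl⟩
    exact variance_testDiff_le_one hG hf _
  rw [stdev, Real.sq_sqrt ((variance_nonneg _ _).trans h)]
  exact h

theorem stdev_nonneg (R S : Measure 𝒳) : 0 ≤ stdev G R S := Real.sqrt_nonneg _

theorem stdev_le_one (hG : IsTestClass G)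
    (R S : Measure 𝒳) [IsProbabilityMeasure R] [IsProbabilityMeasure S] : stdev G R S ≤ 1 := by
  refine Real.sqrt_le_one.2 (Real.sSup_le ?_ zero_le_one)
  rintro _ ⟨f, hf, rfl⟩
  exact variance_testDiff_le_one hG hf _

/-- The second moment is variance plus squared mean, and symmetry of the class bounds the mean on
both sides. -/
theorem integral_testDiff_sq_le (hG : IsTestClass G) (hs : IsSymmetricClass G) {g : 𝒳 → ℝ}
    (hg : g ∈ G) (R S : Measure 𝒳) [IsProbabilityMeasure R] [IsProbabilityMeasure S] :
    ∫ x, (g x.1 - g x.2) ^ 2 ∂(R.prod S) ≤ stdev G R S ^ 2 + dist G R S ^ 2 := by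
  have hmem : MemLp (fun x : 𝒳 × 𝒳 => g x.1 - g x.2) 2 (R.prod S) :=
    MemLp.of_bound (measurable_testDiff hG hg).aestronglyMeasurable 1
      (ae_of_all _ fun x => abs_sub_le_one hG hg x.1 x.2)
  have h1 := variance_eq_sub hmem
  have h2 := variance_le_stdev_sq hG hg R S
  have h3 := sq_le_sq' (by linarith [(abs_le.1 (abs_integral_le_dist hG hs hg R S)).1])
    (abs_le.1 (abs_integral_le_dist hG hs hg R S)).2
  simp only [Pi.pow_apply] at h1
  linarith

/-! ### Conditional exponential moments -/

theorem exp_le_one_add_add_sq {x : ℝ} (hx : |x| ≤ 1) : Real.exp x ≤ 1 + x + x ^ 2 := by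
  have := (abs_le.1 (Real.abs_exp_sub_one_sub_id_le hx)).2
  linarith

/-- From `exp y ≤ 1 + y + y²` for `|y| ≤ 1`, the moment `E exp (θX)` is at most `1 + θm + θ² ≤ exp
(θm + θ²)`. Only an upper bound `m` of the mean is needed. -/
theorem lintegral_exp_le_one {α : Type*} [MeasurableSpace α] {ν : Measure α}
    [IsProbabilityMeasure ν] {X : α → ℝ} (hX : Measurable X) (hb : ∀ x, |X x| ≤ 1) {m : ℝ}
    (hm : ∫ x, X x ∂ν ≤ m) {θ : ℝ} (h0 : 0 ≤ θ) (h1 : θ ≤ 1) :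
    ∫⁻ x, ENNReal.ofReal (Real.exp (θ * (X x - m) - θ ^ 2)) ∂ν ≤ 1 := by
  have hXi : Integrable X ν := Integrable.of_bound hX.aestronglyMeasurable 1 (ae_of_all _ hb)
  have hpt : ∀ x, Real.exp (θ * (X x - m) - θ ^ 2)
      ≤ Real.exp (-(θ * m + θ ^ 2)) * (1 + θ ^ 2 + θ * X x) := fun x => by
    have hθ : |θ * X x| ≤ 1 := by
      rw [abs_mul, abs_of_nonneg h0]
      exact mul_le_one₀ h1 (abs_nonneg _) (hb x)
    have h2 := exp_le_one_add_add_sq hθ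
    have h3 : (θ * X x) ^ 2 ≤ θ ^ 2 := by
      rw [mul_pow]
      exact mul_le_of_le_one_right (sq_nonneg _) (by rw [← sq_abs]; exact pow_le_one₀ (abs_nonneg _) (hb x))
    rw [show θ * (X x - m) - θ ^ 2 = -(θ * m + θ ^ 2) + θ * X x by ring, Real.exp_add]
    exact mul_le_mul_of_nonneg_left (by linarith) (Real.exp_pos _).le
  have hint : Integrable (fun x => 1 + θ ^ 2 + θ * X x) ν :=
    (integrable_const _).add (hXi.const_mul θ)
  calc ∫⁻ x, ENNReal.ofReal (Real.exp (θ * (X x - m) - θ ^ 2)) ∂ν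
      ≤ ∫⁻ x, ENNReal.ofReal (Real.exp (-(θ * m + θ ^ 2)) * (1 + θ ^ 2 + θ * X x)) ∂ν :=
        lintegral_mono fun x => ENNReal.ofReal_le_ofReal (hpt x)
    _ = ENNReal.ofReal (∫ x, Real.exp (-(θ * m + θ ^ 2)) * (1 + θ ^ 2 + θ * X x) ∂ν) :=
        (ofReal_integral_eq_lintegral_ofReal (hint.const_mul _)
          (ae_of_all _ fun x => (Real.exp_pos _).le.trans (hpt x))).symm
    _ ≤ 1 := by
        rw [integral_const_mul, integral_add (integrable_const _) (hXi.const_mul θ),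
          integral_const_mul, integral_const, probReal_univ, one_smul, Real.exp_neg]
        refine ENNReal.ofReal_le_one.2 ?_
        rw [inv_mul_le_one₀ (Real.exp_pos _)]
        have := Real.add_one_le_exp (θ * m + θ ^ 2)
        have := mul_le_mul_of_nonneg_left hm h0
        linarith

/-- On `[0, 1]` one has `X² ≤ X`, hence `exp X ≤ 1 + 2X`. The price is the factor 2 on the mean; in
exchange the compensator is proportional to the mean, which lets the variance survive into the bound
on squared payoffs. -/
theorem lintegral_exp_le_one_of_nonneg {α : Type*} [MeasurableSpace α] {ν : Measure α}
    [IsProbabilityMeasure ν] {X : α → ℝ} (hX : Measurable X) (hb : ∀ x, X x ∈ Set.Icc (0 : ℝ) 1)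
    {m : ℝ} (hm : ∫ x, X x ∂ν ≤ m) :
    ∫⁻ x, ENNReal.ofReal (Real.exp (X x - 2 * m)) ∂ν ≤ 1 := by
  have hXi : Integrable X ν := Integrable.of_bound hX.aestronglyMeasurable 1
    (ae_of_all _ fun x => by rw [Real.norm_eq_abs, abs_of_nonneg (hb x).1]; exact (hb x).2)
  have hpt : ∀ x, Real.exp (X x - 2 * m) ≤ Real.exp (-(2 * m)) * (1 + 2 * X x) := fun x => by
    have h2 := exp_le_one_add_add_sq (x := X x) (by rw [abs_of_nonneg (hb x).1]; exact (hb x).2)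
    have h3 : X x ^ 2 ≤ X x := by nlinarith [(hb x).1, (hb x).2]
    rw [show X x - 2 * m = -(2 * m) + X x by ring, Real.exp_add]
    exact mul_le_mul_of_nonneg_left (by linarith) (Real.exp_pos _).le
  have hint : Integrable (fun x => 1 + 2 * X x) ν := (integrable_const _).add (hXi.const_mul 2)
  calc ∫⁻ x, ENNReal.ofReal (Real.exp (X x - 2 * m)) ∂ν
      ≤ ∫⁻ x, ENNReal.ofReal (Real.exp (-(2 * m)) * (1 + 2 * X x)) ∂ν :=
        lintegral_mono fun x => ENNReal.ofReal_le_ofReal (hpt x)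
    _ = ENNReal.ofReal (∫ x, Real.exp (-(2 * m)) * (1 + 2 * X x) ∂ν) :=
        (ofReal_integral_eq_lintegral_ofReal (hint.const_mul _)
          (ae_of_all _ fun x => (Real.exp_pos _).le.trans (hpt x))).symm
    _ ≤ 1 := by
        rw [integral_const_mul, integral_add (integrable_const _) (hXi.const_mul 2),
          integral_const_mul, integral_const, probReal_univ, one_smul, Real.exp_neg]
        refine ENNReal.ofReal_le_one.2 ?_
        rw [inv_mul_le_one₀ (Real.exp_pos _)]
        have := Real.add_one_le_exp (2 * m)
        linarith

/-! ### Sums along the sample path -/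

/-- The number of slots in which source `k` is selected. -/
noncomputable def numPulls (Y : ℕ → Ω → Obs K 𝒳) (k : Fin K) (n : ℕ) (ω : Ω) : ℝ :=
  ∑ i ∈ Finset.range n, if (Y i ω).1 = k then 1 else 0

/-- The sum of the payoffs of source `k`. -/
noncomputable def payoffSum (A : Prediction K 𝒳) (Y : ℕ → Ω → Obs K 𝒳) (k : Fin K) (n : ℕ)
    (ω : Ω) : ℝ :=
  ∑ i ∈ Finset.range n,
    if (Y i ω).1 = k then slotPayoff A i (history Y i ω) (Y i ω) else 0

/-- The sum of the squared payoffs of source `k`. -/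
noncomputable def payoffSqSum (A : Prediction K 𝒳) (Y : ℕ → Ω → Obs K 𝒳) (k : Fin K) (n : ℕ)
    (ω : Ω) : ℝ :=
  ∑ i ∈ Finset.range n,
    if (Y i ω).1 = k then slotPayoff A i (history Y i ω) (Y i ω) ^ 2 else 0

/-- The sum of `g(X₁) - g(X₂)` over the slots in which source `k` is selected. -/
noncomputable def testSum (g : 𝒳 → ℝ) (Y : ℕ → Ω → Obs K 𝒳) (k : Fin K) (n : ℕ) (ω : Ω) : ℝ :=
  ∑ i ∈ Finset.range n, if (Y i ω).1 = k then g (Y i ω).2.1 - g (Y i ω).2.2 else 0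

/-- Source `k` has the largest running average after the history `h`. -/
def IsLeader (A : Prediction K 𝒳) {n : ℕ} (h : Hist K 𝒳 n) (k : Fin K) : Prop :=
  ∀ j, empMean A j h ≤ empMean A k h

open Classical in
/-- The number of slots in which a source without the largest running average is selected. -/
noncomputable def numExplore (A : Prediction K 𝒳) (Y : ℕ → Ω → Obs K 𝒳) (n : ℕ) (ω : Ω) : ℝ :=
  ∑ i ∈ Finset.range n, if IsLeader A (history Y i ω) (Y i ω).1 then 0 else 1

/-- The sum of the exploration rates. -/
noncomputable def explorationMass (C : ℝ) (n : ℕ) : ℝ :=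
  ∑ i ∈ Finset.range n, explorationRate C (i + 1)

/-- The tail bound for sums over the slots of a single source. -/
theorem measure_source_sum_le [IsProbabilityMeasure μ] [∀ k, IsProbabilityMeasure (P k)]
    [∀ k, IsProbabilityMeasure (Q k)] [∀ n, IsMarkovKernel (π n)]
    (hY : IsSampling μ P Q π Y) (k : Fin K) {ψ : (n : ℕ) → Hist K 𝒳 n → Obs K 𝒳 → ℝ}
    (hψ : ∀ n, Measurable fun y : Hist K 𝒳 n × Obs K 𝒳 => ψ n y.1 y.2)
    (hle : ∀ n h,
      ∫⁻ x, ENNReal.ofReal (Real.exp (ψ n h (k, x))) ∂((P k).prod (Q k)) ≤ 1) (n : ℕ) (x : ℝ) :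
    μ {ω | x ≤ ∑ i ∈ Finset.range n,
        if (Y i ω).1 = k then ψ i (history Y i ω) (Y i ω) else 0}
      ≤ ENNReal.ofReal (Real.exp (-x)) := by
  refine measure_le_exp_neg hY (φ := fun n h o => if o.1 = k then ψ n h o else 0)
    (fun n => Measurable.ite ((measurable_fst.comp measurable_snd) (measurableSet_singleton k))
      (hψ n) measurable_const) (fun n h => sum_mul_le_one _ fun j => ?_) n x
  by_cases hj : j = k
  · subst hj
    simpa using hle n h
  · simp [hj]

/-- Whatever function the strategy predicts, its conditional mean on source `k` is at most the
distance of that source. -/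
theorem measure_payoffSum_ge [IsProbabilityMeasure μ] [∀ k, IsProbabilityMeasure (P k)]
    [∀ k, IsProbabilityMeasure (Q k)] [∀ n, IsMarkovKernel (π n)] (hG : IsTestClass G)
    (hA : IsPrediction G A) (hY : IsSampling μ P Q π Y) (k : Fin K) {θ : ℝ} (h0 : 0 ≤ θ)
    (h1 : θ ≤ 1) (n : ℕ) (x : ℝ) :
    μ {ω | x ≤ θ * (payoffSum A Y k n ω - dist G (P k) (Q k) * numPulls Y k n ω)
        - θ ^ 2 * numPulls Y k n ω} ≤ ENNReal.ofReal (Real.exp (-x)) := by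
  have h := measure_source_sum_le hY k
    (ψ := fun n h o => θ * (slotPayoff A n h o - dist G (P k) (Q k)) - θ ^ 2)
    (fun n => (((measurable_slotPayoff hA n).sub_const _).const_mul θ).sub_const _)
    (fun n h => lintegral_exp_le_one (measurable_testDiff hG (hA.mem k n h))
      (fun x => abs_sub_le_one hG (hA.mem k n h) _ _)
      (integral_le_dist hG (hA.mem k n h) _ _) h0 h1) n x
  convert h using 4 with ω
  simp only [payoffSum, numPulls, Finset.mul_sum, ← Finset.sum_sub_distrib]
  refine iff_of_eq (congrArg (x ≤ ·) (Finset.sum_congr rfl fun i _ => ?_))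
  split_ifs <;> ring

/-- The lower tail is taken for one fixed test function. A free lower bound `m` of its mean allows
near-maximizers, as the supremum in the distance need not be attained. -/
theorem measure_testSum_le [IsProbabilityMeasure μ] [∀ k, IsProbabilityMeasure (P k)]
    [∀ k, IsProbabilityMeasure (Q k)] [∀ n, IsMarkovKernel (π n)] (hG : IsTestClass G)
    (hY : IsSampling μ P Q π Y) (k : Fin K) {g : 𝒳 → ℝ} (hg : g ∈ G) {m : ℝ}
    (hm : m ≤ ∫ x, (g x.1 - g x.2) ∂((P k).prod (Q k))) {θ : ℝ} (h0 : 0 ≤ θ)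
    (h1 : θ ≤ 1) (n : ℕ) (x : ℝ) :
    μ {ω | x ≤ θ * (m * numPulls Y k n ω - testSum g Y k n ω)
        - θ ^ 2 * numPulls Y k n ω} ≤ ENNReal.ofReal (Real.exp (-x)) := by
  have hmeas : Measurable fun o : Obs K 𝒳 => g o.2.1 - g o.2.2 :=
    (measurable_testDiff hG hg).comp measurable_snd
  have h := measure_source_sum_le hY k
    (ψ := fun n h o => θ * (-(g o.2.1 - g o.2.2) - (-m)) - θ ^ 2)
    (fun n => ((((hmeas.comp measurable_snd).neg).sub_const _).const_mul θ).sub_const _)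
    (fun n h => lintegral_exp_le_one (X := fun x : 𝒳 × 𝒳 => -(g x.1 - g x.2))
      (measurable_testDiff hG hg).neg
      (fun x => by rw [abs_neg]; exact abs_sub_le_one hG hg _ _)
      (by rw [integral_neg]; linarith) h0 h1) n x
  convert h using 4 with ω
  simp only [testSum, numPulls, Finset.mul_sum, ← Finset.sum_sub_distrib]
  refine iff_of_eq (congrArg (x ≤ ·) (Finset.sum_congr rfl fun i _ => ?_))
  split_ifs <;> ring

theorem measure_payoffSqSum_ge [IsProbabilityMeasure μ] [∀ k, IsProbabilityMeasure (P k)]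
    [∀ k, IsProbabilityMeasure (Q k)] [∀ n, IsMarkovKernel (π n)] (hG : IsTestClass G)
    (hs : IsSymmetricClass G) (hA : IsPrediction G A) (hY : IsSampling μ P Q π Y) (k : Fin K)
    (n : ℕ) (x : ℝ) :
    μ {ω | x ≤ payoffSqSum A Y k n ω
        - 2 * (stdev G (P k) (Q k) ^ 2 + dist G (P k) (Q k) ^ 2) * numPulls Y k n ω}
      ≤ ENNReal.ofReal (Real.exp (-x)) := by
  have h := measure_source_sum_le hY k
    (ψ := fun n h o => slotPayoff A n h o ^ 2
      - 2 * (stdev G (P k) (Q k) ^ 2 + dist G (P k) (Q k) ^ 2))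
    (fun n => ((measurable_slotPayoff hA n).pow_const 2).sub_const _)
    (fun n h => lintegral_exp_le_one_of_nonneg
      ((measurable_testDiff hG (hA.mem k n h)).pow_const 2)
      (fun x => ⟨sq_nonneg _, by
        rw [← sq_abs]
        exact pow_le_one₀ (abs_nonneg _) (abs_sub_le_one hG (hA.mem k n h) _ _)⟩)
      (integral_testDiff_sq_le hG hs (hA.mem k n h) _ _)) n x
  convert h using 4 with ω
  simp only [payoffSqSum, numPulls, Finset.mul_sum, ← Finset.sum_sub_distrib]
  refine iff_of_eq (congrArg (x ≤ ·) (Finset.sum_congr rfl fun i _ => ?_))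
  split_ifs <;> ring

end ActiveTest

/-! ### Path quantities and the amount of exploration -/

namespace ActiveTest

variable {K : ℕ} {𝒳 Ω : Type*} {Y : ℕ → Ω → Obs K 𝒳} {G : Set (𝒳 → ℝ)} {A : Prediction K 𝒳} {C : ℝ}

/-! ### Quantities of a history along the sample path -/

theorem count_history (k : Fin K) (n : ℕ) (ω : Ω) :
    (count k (history Y n ω) : ℝ) = numPulls Y k n ω := by
  simp only [count, numPulls]
  push_cast
  exact Fin.sum_univ_eq_sum_range (fun i => if (Y i ω).1 = k then (1 : ℝ) else 0) n

theorem sum_payoff_history (A : Prediction K 𝒳) (k : Fin K) (n : ℕ) (ω : Ω) :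
    (∑ i : Fin n, if (history Y n ω i).1 = k then payoff A (history Y n ω) i else 0)
      = payoffSum A Y k n ω :=
  Fin.sum_univ_eq_sum_range
    (fun i => if (Y i ω).1 = k then slotPayoff A i (history Y i ω) (Y i ω) else 0) n

theorem sum_test_history (g : 𝒳 → ℝ) (k : Fin K) (n : ℕ) (ω : Ω) :
    (∑ i : Fin n, if (history Y n ω i).1 = k
      then g (history Y n ω i).2.1 - g (history Y n ω i).2.2 else 0) = testSum g Y k n ω :=
  Fin.sum_univ_eq_sum_range
    (fun i => if (Y i ω).1 = k then g (Y i ω).2.1 - g (Y i ω).2.2 else 0) n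

theorem empMean_history_of_pos {k : Fin K} {n : ℕ} {ω : Ω} (h : 0 < numPulls Y k n ω) :
    empMean A k (history Y n ω) = ((payoffSum A Y k n ω / numPulls Y k n ω : ℝ) : EReal) := by
  rw [empMean, if_neg, sum_payoff_history, count_history]
  intro h0
  rw [← count_history, h0] at h
  simp at h

theorem empMean_history_of_not_pos {k : Fin K} {n : ℕ} {ω : Ω} (h : ¬ 0 < numPulls Y k n ω) :
    empMean A k (history Y n ω) = ⊥ := by
  rw [empMean, if_pos]
  rw [← count_history] at h
  simpa using h

theorem numPulls_nonneg (k : Fin K) (n : ℕ) (ω : Ω) : 0 ≤ numPulls Y k n ω :=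
  Finset.sum_nonneg fun i _ => by split_ifs <;> norm_num

theorem sum_numPulls (n : ℕ) (ω : Ω) : ∑ k, numPulls Y k n ω = n := by
  simp only [numPulls]
  rw [Finset.sum_comm]
  simp

theorem numPulls_le (k : Fin K) (n : ℕ) (ω : Ω) : numPulls Y k n ω ≤ n := by
  rw [← sum_numPulls (Y := Y) n ω]
  exact Finset.single_le_sum (fun k _ => numPulls_nonneg k n ω) (Finset.mem_univ k)

theorem abs_payoffSum_le [MeasurableSpace 𝒳] (hG : IsTestClass G) (hA : IsPrediction G A)
    (k : Fin K) (n : ℕ) (ω : Ω) : |payoffSum A Y k n ω| ≤ numPulls Y k n ω := by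
  refine (Finset.abs_sum_le_sum_abs _ _).trans (Finset.sum_le_sum fun i _ => ?_)
  split_ifs
  · exact abs_slotPayoff_le hG hA _ _ _
  · simp

theorem abs_testSum_le [MeasurableSpace 𝒳] (hG : IsTestClass G) {g : 𝒳 → ℝ} (hg : g ∈ G)
    (k : Fin K) (n : ℕ) (ω : Ω) : |testSum g Y k n ω| ≤ numPulls Y k n ω := by
  refine (Finset.abs_sum_le_sum_abs _ _).trans (Finset.sum_le_sum fun i _ => ?_)
  split_ifs
  · exact abs_sub_le_one hG hg _ _
  · simp

theorem sum_payoffSum (A : Prediction K 𝒳) (n : ℕ) (ω : Ω) :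
    ∑ k, payoffSum A Y k n ω
      = ∑ i ∈ Finset.range n, slotPayoff A i (history Y i ω) (Y i ω) := by
  simp only [payoffSum]
  rw [Finset.sum_comm]
  simp

theorem regret_history (G : Set (𝒳 → ℝ)) (A : Prediction K 𝒳) (k : Fin K) (n : ℕ) (ω : Ω) :
    regret G A k (history Y n ω)
      = sSup ((fun g => testSum g Y k n ω - payoffSum A Y k n ω) '' G) := by
  simp only [regret, sum_payoff_history, sum_test_history]

theorem testSum_sub_payoffSum_le [MeasurableSpace 𝒳] (hG : IsTestClass G)
    (hA : IsPrediction G A) {g : 𝒳 → ℝ} (hg : g ∈ G) (k : Fin K) (n : ℕ) (ω : Ω) :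
    testSum g Y k n ω - payoffSum A Y k n ω ≤ 2 * n := by
  linarith [(abs_le.1 (abs_testSum_le (Y := Y) hG hg k n ω)).2, numPulls_le (Y := Y) k n ω,
    (abs_le.1 (abs_payoffSum_le (Y := Y) hG hA k n ω)).1]

/-- Regret converts concentration of a single fixed `g` into a lower bound for the adaptive payoffs.
The bound `2n` makes the real supremum genuine. -/
theorem testSum_sub_regret_le [MeasurableSpace 𝒳] (hG : IsTestClass G) (hA : IsPrediction G A)
    {g : 𝒳 → ℝ} (hg : g ∈ G) (k : Fin K) (n : ℕ) (ω : Ω) :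
    testSum g Y k n ω - regret G A k (history Y n ω) ≤ payoffSum A Y k n ω := by
  have h : testSum g Y k n ω - payoffSum A Y k n ω ≤ regret G A k (history Y n ω) := by
    rw [regret_history]
    refine le_csSup ⟨2 * n, ?_⟩ ⟨g, hg, rfl⟩
    rintro _ ⟨f, hf, rfl⟩
    exact testSum_sub_payoffSum_le hG hA hf k n ω
  linarith

theorem regret_le [MeasurableSpace 𝒳] (hG : IsTestClass G) (hA : IsPrediction G A)
    (k : Fin K) (n : ℕ) (ω : Ω) : regret G A k (history Y n ω) ≤ 2 * n := by
  rw [regret_history]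
  refine Real.sSup_le ?_ (by positivity)
  rintro _ ⟨f, hf, rfl⟩
  exact testSum_sub_payoffSum_le hG hA hf k n ω

/-! ### Exploration -/

theorem explorationRate_nonneg {C : ℝ} (hC : 0 ≤ C) (n : ℕ) : 0 ≤ explorationRate C n :=
  le_min zero_le_one (by positivity)

/-- Integral comparison: while the rate is capped at 1 the logarithm is still nonpositive, and
afterwards each rate `C / (n + 1)` dominates the increment of `C log`. -/
theorem le_explorationMass {C : ℝ} (hC : 0 < C) (n : ℕ) :
    C * Real.log ((n + 1) / (C + 1)) ≤ explorationMass C n := by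
  have hnn : ∀ n, 0 ≤ explorationMass C n := fun n =>
    Finset.sum_nonneg fun i _ => explorationRate_nonneg hC.le _
  induction n with
  | zero =>
    refine le_trans ?_ (hnn 0)
    refine mul_nonpos_of_nonneg_of_nonpos hC.le (Real.log_nonpos (by positivity) ?_)
    rw [div_le_one (by positivity)]
    push_cast
    linarith
  | succ n ih =>
    rcases le_total ((n : ℝ) + 1) C with h | h
    · refine le_trans ?_ (hnn _)
      refine mul_nonpos_of_nonneg_of_nonpos hC.le (Real.log_nonpos (by positivity) ?_)
      rw [div_le_one (by positivity)]
      push_cast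
      linarith
    · have hn : (0 : ℝ) < n + 1 := by positivity
      have hrate : explorationRate C (n + 1) = C / (n + 1) := by
        rw [explorationRate, min_eq_right]
        · push_cast; rfl
        · rw [div_le_one (by positivity)]; push_cast; exact h
      have hlog : Real.log ((n + 1 + 1) / (C + 1)) - Real.log ((n + 1) / (C + 1))
          ≤ 1 / (n + 1) := by
        rw [← Real.log_div (by positivity) (by positivity)]
        have := Real.log_le_sub_one_of_pos
          (x := ((n : ℝ) + 1 + 1) / (C + 1) / ((n + 1) / (C + 1))) (by positivity)
        refine this.trans (le_of_eq ?_)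
        field_simp
        ring
      rw [explorationMass, Finset.sum_range_succ, hrate]
      have h2 := mul_le_mul_of_nonneg_left hlog hC.le
      have h3 : C * (1 / ((n : ℝ) + 1)) = C / (n + 1) := by ring
      rw [explorationMass] at ih
      push_cast
      linarith

theorem explorationMass_le {C : ℝ} (hC : 0 ≤ C) (n : ℕ) :
    explorationMass C n ≤ C * (1 + Real.log n) := by
  have h := harmonic_le_one_add_log n
  have h2 : explorationMass C n ≤ C * (harmonic n : ℝ) := by
    rw [harmonic, explorationMass]
    push_cast
    rw [Finset.mul_sum]
    refine Finset.sum_le_sum fun i _ => (min_le_right _ _).trans (le_of_eq ?_)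
    push_cast
    rw [div_eq_mul_inv]
  exact h2.trans (mul_le_mul_of_nonneg_left h hC)

variable [MeasurableSpace 𝒳] [MeasurableSpace Ω] {μ : Measure Ω} {P Q : Fin K → Measure 𝒳}
  {π : Selection K 𝒳}

theorem measurable_empMean (hA : IsPrediction G A) (k : Fin K) (n : ℕ) :
    Measurable fun h : Hist K 𝒳 n => empMean A k h := by
  have hsel : ∀ i, MeasurableSet {h : Hist K 𝒳 n | (h i).1 = k} := fun i =>
    (measurable_fst.comp (measurable_pi_apply i)) (measurableSet_singleton k)
  have hc : Measurable fun h : Hist K 𝒳 n => count k h :=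
    Finset.measurable_fun_sum _ fun i _ =>
      Measurable.ite (hsel i) measurable_const measurable_const
  refine Measurable.ite (hc (measurableSet_singleton 0)) measurable_const
    (measurable_coe_real_ereal.comp (Measurable.div ?_ (measurable_from_top.comp hc)))
  exact Finset.measurable_fun_sum _ fun i _ =>
    Measurable.ite (hsel i) (measurable_payoff hA i) measurable_const

theorem measurableSet_isLeader (hA : IsPrediction G A) (k : Fin K) (n : ℕ) :
    MeasurableSet {h : Hist K 𝒳 n | IsLeader A h k} := by
  have : {h : Hist K 𝒳 n | IsLeader A h k} = ⋂ j, {h | empMean A j h ≤ empMean A k h} := by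
    ext h
    simp [IsLeader]
  rw [this]
  exact MeasurableSet.iInter fun j =>
    measurableSet_le (measurable_empMean hA j n) (measurable_empMean hA k n)

theorem measurableSet_isLeader_prod (hA : IsPrediction G A) (n : ℕ) :
    MeasurableSet {y : Hist K 𝒳 n × Obs K 𝒳 | IsLeader A y.1 y.2.1} := by
  have : {y : Hist K 𝒳 n × Obs K 𝒳 | IsLeader A y.1 y.2.1}
      = ⋃ k, (Prod.fst ⁻¹' {h : Hist K 𝒳 n | IsLeader A h k}) ∩ {y | y.2.1 = k} := by
    ext y
    simp
  rw [this]
  exact MeasurableSet.iUnion fun k => (measurable_fst (measurableSet_isLeader hA k n)).inter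
    ((measurable_fst.comp measurable_snd) (measurableSet_singleton k))

theorem explorationRate_div_le (hπ : IsEpsGreedy A C π) (n : ℕ) (h : Hist K 𝒳 n) (k : Fin K) :
    ENNReal.ofReal (explorationRate C (n + 1) / K) ≤ π n h {k} := by
  obtain ⟨ρ, hρ⟩ := hπ
  rw [((hρ n).2 h k).2]
  exact le_add_self

theorem selection_of_not_isLeader (hπ : IsEpsGreedy A C π) {n : ℕ} {h : Hist K 𝒳 n} {k : Fin K}
    (hk : ¬ IsLeader A h k) : π n h {k} = ENNReal.ofReal (explorationRate C (n + 1) / K) := by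
  obtain ⟨ρ, hρ⟩ := hπ
  have h0 : ρ n h {k} = 0 := by
    by_contra hne
    exact hk (((hρ n).2 h k).1 hne)
  rw [((hρ n).2 h k).2, h0, mul_zero, zero_add]

theorem sum_toReal_singleton (ν : Measure (Fin K)) [IsProbabilityMeasure ν] :
    ∑ k, (ν {k}).toReal = 1 := by
  rw [← ENNReal.toReal_sum fun k _ => measure_ne_top ν _, sum_prob_singleton, ENNReal.toReal_one]

theorem sum_mul_ofReal_le_one (ν : Measure (Fin K)) [IsProbabilityMeasure ν] {c : Fin K → ℝ}
    (hc0 : ∀ k, 0 ≤ c k) (hc : ∑ k, (ν {k}).toReal * c k ≤ 1) :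
    ∑ k, ν {k} * ENNReal.ofReal (c k) ≤ 1 := by
  have h : ∀ k, ν {k} * ENNReal.ofReal (c k) = ENNReal.ofReal ((ν {k}).toReal * c k) := fun k => by
    rw [ENNReal.ofReal_mul ENNReal.toReal_nonneg, ENNReal.ofReal_toReal (measure_ne_top ν _)]
  simp_rw [h]
  rw [← ENNReal.ofReal_sum_of_nonneg fun k _ => mul_nonneg ENNReal.toReal_nonneg (hc0 k)]
  exact ENNReal.ofReal_le_one.2 hc

/-- Every source is selected with conditional probability at least `ε / K`. Asking for only half of
this mass leaves room for the exponential moment, since `1 - exp (-1) ≥ 1/2`. -/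
theorem measure_numPulls_le [IsProbabilityMeasure μ] [∀ k, IsProbabilityMeasure (P k)]
    [∀ k, IsProbabilityMeasure (Q k)] [∀ n, IsMarkovKernel (π n)]
    (hY : IsSampling μ P Q π Y) (hπ : IsEpsGreedy A C π)
    (k : Fin K) (n : ℕ) (x : ℝ) :
    μ {ω | x ≤ explorationMass C n / (2 * K) - numPulls Y k n ω}
      ≤ ENNReal.ofReal (Real.exp (-x)) := by
  have h := measure_le_exp_neg hY
    (φ := fun n _ o => explorationRate C (n + 1) / (2 * K) - if o.1 = k then 1 else 0)
    (fun n => measurable_const.sub (Measurable.ite ((measurable_fst.comp measurable_snd)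
      (measurableSet_singleton k)) measurable_const measurable_const))
    (fun n h => by
      change ∑ j, π n h {j} * ∫⁻ _ : 𝒳 × 𝒳, ENNReal.ofReal (Real.exp
        (explorationRate C (n + 1) / (2 * K) - if j = k then 1 else 0)) ∂((P j).prod (Q j)) ≤ 1
      simp only [lintegral_const, measure_univ, mul_one]
      refine sum_mul_ofReal_le_one _ (fun _ => (Real.exp_pos _).le) ?_
      set c := explorationRate C (n + 1) / (2 * K) with hc
      set p := (π n h {k}).toReal with hp
      have hcp : 2 * c ≤ p := by
        have h1 := explorationRate_div_le hπ n h k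
        rw [ENNReal.ofReal_le_iff_le_toReal (measure_ne_top _ _)] at h1
        refine le_trans (le_of_eq ?_) h1
        rw [hc]
        ring
      have hp0 : 0 ≤ p := ENNReal.toReal_nonneg
      have hval : ∀ j, (π n h {j}).toReal * Real.exp (c - if j = k then 1 else 0)
          = Real.exp c * ((π n h {j}).toReal
            - if j = k then (π n h {j}).toReal * (1 - Real.exp (-1)) else 0) := fun j => by
        split_ifs
        · rw [sub_eq_add_neg, Real.exp_add]; ring
        · rw [sub_zero]; ring
      simp_rw [hval]
      rw [← Finset.mul_sum, Finset.sum_sub_distrib, sum_toReal_singleton, Finset.sum_ite_eq']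
      simp only [Finset.mem_univ, if_true]
      have he : Real.exp (-1) ≤ 1 / 2 := by
        rw [Real.exp_neg, inv_le_comm₀ (Real.exp_pos _) (by norm_num)]
        linarith [Real.exp_one_gt_d9]
      have h2 : 1 - p * (1 - Real.exp (-1)) ≤ Real.exp (-c) := by
        have := Real.add_one_le_exp (-c)
        nlinarith
      calc Real.exp c * (1 - p * (1 - Real.exp (-1))) ≤ Real.exp c * Real.exp (-c) :=
            mul_le_mul_of_nonneg_left h2 (Real.exp_pos _).le
        _ = 1 := by rw [← Real.exp_add]; simp) n x
  convert h using 4 with ω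
  rw [Finset.sum_sub_distrib, explorationMass, numPulls, Finset.sum_div]

/-- A non-leader is selected with probability exactly `ε / K`, so all non-leaders together have at
most `ε`. Then `exp 1 ≤ 1 + 2` bounds the exponential moment by `1 + 2ε ≤ exp (2ε)`. -/
theorem measure_numExplore_ge [IsProbabilityMeasure μ] [∀ k, IsProbabilityMeasure (P k)]
    [∀ k, IsProbabilityMeasure (Q k)] [∀ n, IsMarkovKernel (π n)]
    (hA : IsPrediction G A) (hY : IsSampling μ P Q π Y) (hπ : IsEpsGreedy A C π) (hC : 0 ≤ C)
    (n : ℕ) (x : ℝ) :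
    μ {ω | x ≤ numExplore A Y n ω - 2 * explorationMass C n}
      ≤ ENNReal.ofReal (Real.exp (-x)) := by
  classical
  have h := measure_le_exp_neg hY
    (φ := fun n h o => (if IsLeader A h o.1 then 0 else 1) - 2 * explorationRate C (n + 1))
    (fun n => (Measurable.ite (measurableSet_isLeader_prod hA n) measurable_const
      measurable_const).sub_const _)
    (fun n h => by
      change ∑ j, π n h {j} * ∫⁻ _ : 𝒳 × 𝒳, ENNReal.ofReal (Real.exp
        ((if IsLeader A h j then 0 else 1) - 2 * explorationRate C (n + 1)))
          ∂((P j).prod (Q j)) ≤ 1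
      simp only [lintegral_const, measure_univ, mul_one]
      refine sum_mul_ofReal_le_one _ (fun _ => (Real.exp_pos _).le) ?_
      set ε := explorationRate C (n + 1) with hε
      have hε0 : 0 ≤ ε := explorationRate_nonneg hC _
      have hval : ∀ j, (π n h {j}).toReal
            * Real.exp ((if IsLeader A h j then 0 else 1) - 2 * ε)
          ≤ Real.exp (-(2 * ε)) * ((π n h {j}).toReal + 2 * (ε / K)) := fun j => by
        have hK : 0 ≤ ε / K := by positivity
        rw [sub_eq_add_neg, Real.exp_add]
        split_ifs with hj
        · rw [Real.exp_zero, one_mul, mul_comm]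
          exact mul_le_mul_of_nonneg_left (by linarith) (Real.exp_pos _).le
        · rw [selection_of_not_isLeader hπ hj, ENNReal.toReal_ofReal hK]
          rw [show ε / K * (Real.exp 1 * Real.exp (-(2 * ε)))
            = Real.exp (-(2 * ε)) * (ε / K * Real.exp 1) by ring]
          refine mul_le_mul_of_nonneg_left ?_ (Real.exp_pos _).le
          nlinarith [Real.exp_one_lt_d9]
      refine (Finset.sum_le_sum fun j _ => hval j).trans ?_
      rw [← Finset.mul_sum, Finset.sum_add_distrib, sum_toReal_singleton, Finset.sum_const,
        Finset.card_univ, Fintype.card_fin, nsmul_eq_mul]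
      have h1 : (K : ℝ) * (2 * (ε / K)) ≤ 2 * ε := by
        rcases Nat.eq_zero_or_pos K with rfl | hK
        · simpa using hε0
        · have : (K : ℝ) ≠ 0 := by positivity
          field_simp
          exact le_rfl
      calc Real.exp (-(2 * ε)) * (1 + (K : ℝ) * (2 * (ε / K)))
          ≤ Real.exp (-(2 * ε)) * Real.exp (2 * ε) := by
            refine mul_le_mul_of_nonneg_left ?_ (Real.exp_pos _).le
            linarith [Real.add_one_le_exp (2 * ε)]
        _ = 1 := by rw [← Real.exp_add]; simp) n x
  convert h using 4 with ω
  rw [Finset.sum_sub_distrib, explorationMass, numExplore, Finset.mul_sum]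

end ActiveTest

/-! ### Almost sure crossing under the alternative -/

namespace ActiveTest

variable {K : ℕ} {𝒳 Ω : Type*} {Y : ℕ → Ω → Obs K 𝒳} {G : Set (𝒳 → ℝ)} {A : Prediction K 𝒳}

/-! ### Power one -/

theorem ae_eventually_notMem_of_exp {Ω : Type*} [MeasurableSpace Ω] {μ : Measure Ω}
    {s : ℕ → Set Ω} {f : ℕ → ℝ} (hs : ∀ n, μ (s n) ≤ ENNReal.ofReal (Real.exp (-f n))) {c : ℝ}
    (hc : 0 < c) (hf : ∀ᶠ n : ℕ in atTop, c * n ≤ f n) : ∀ᵐ ω ∂μ, ∀ᶠ n in atTop, ω ∉ s n := by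
  obtain ⟨N, hN⟩ := eventually_atTop.1 hf
  let s' : ℕ → Set Ω := fun n => if N ≤ n then s n else ∅
  have hs' : ∀ n, μ (s' n) ≤ ENNReal.ofReal (Real.exp (-c) ^ n) := fun n => by
    by_cases h : N ≤ n
    · simp only [s', if_pos h]
      refine (hs n).trans (ENNReal.ofReal_le_ofReal ?_)
      rw [← Real.exp_nat_mul]
      exact Real.exp_le_exp.2 (by linarith [hN n h])
    · simp [s', h]
  have hsum : Summable fun n : ℕ => Real.exp (-c) ^ n :=
    summable_geometric_of_lt_one (Real.exp_pos _).le (Real.exp_lt_one_iff.2 (by linarith))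
  have hfin : ∑' n, μ (s' n) ≠ ∞ := by
    refine ne_top_of_le_ne_top ?_ (ENNReal.tsum_le_tsum hs')
    rw [← ENNReal.ofReal_tsum_of_nonneg (fun n => by positivity) hsum]
    exact ENNReal.ofReal_ne_top
  filter_upwards [ae_eventually_notMem hfin] with ω hω
  filter_upwards [hω, eventually_ge_atTop N] with n h1 h2
  simpa [s', h2] using h1

theorem eventually_log_le {c : ℝ} (hc : 0 < c) (b : ℝ) :
    ∀ᶠ n : ℕ in atTop, b + 2 * Real.log (1 + 4 * n) ≤ c * n := by
  have hlin : Tendsto (fun n : ℕ => 1 + 4 * (n : ℝ)) atTop atTop :=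
    tendsto_atTop_add_const_left _ _
      (tendsto_natCast_atTop_atTop.const_mul_atTop (by norm_num : (0 : ℝ) < 4))
  -- Twice `(c/16)(1 + 4n)` is `c/8 + cn/2`; the other half of `cn` absorbs `b + c/8`.
  have h1 := hlin.eventually (Real.isLittleO_log_id_atTop.bound (show 0 < c / 16 by positivity))
  have h2 := tendsto_natCast_atTop_atTop.eventually_ge_atTop ((b + c / 8) / (c / 2))
  filter_upwards [h1, h2] with n h1 h2
  rw [div_le_iff₀ (by positivity)] at h2
  simp only [id, Real.norm_eq_abs] at h1
  rw [abs_of_nonneg (by positivity : 0 ≤ 1 + 4 * (n : ℝ))] at h1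
  have h3 := (le_abs_self _).trans h1
  nlinarith

/-- A leader's average is at least that of `a`, hence positive; a source never selected has average
`⊥` and cannot lead. -/
theorem payoffSum_pos_of_isLeader [MeasurableSpace 𝒳] (hG : IsTestClass G)
    (hA : IsPrediction G A) {a k : Fin K} {n : ℕ} {ω : Ω} (ha : 0 < payoffSum A Y a n ω)
    (hk : IsLeader A (history Y n ω) k) : 0 < payoffSum A Y k n ω := by
  have hN : 0 < numPulls Y a n ω :=
    ha.trans_le ((le_abs_self _).trans (abs_payoffSum_le hG hA a n ω))
  have h := hk a
  rw [empMean_history_of_pos hN] at h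
  by_cases hNk : 0 < numPulls Y k n ω
  · rw [empMean_history_of_pos hNk, EReal.coe_le_coe_iff] at h
    exact (div_pos_iff_of_pos_right hNk).1 ((div_pos ha hN).trans_le h)
  · rw [empMean_history_of_not_pos hNk] at h
    simp at h

/-- After `T`, a slot selecting `k` as leader starts from a positive sum and ends above -1, which
explains the term `-1`. Any other slot selecting `k` costs at most 1 and is counted by `numExplore`.
-/
theorem payoffSum_ge_of_leader_pos [MeasurableSpace 𝒳] (hG : IsTestClass G)
    (hA : IsPrediction G A) {a : Fin K} {T : ℕ} {ω : Ω}
    (ha : ∀ n, T ≤ n → 0 < payoffSum A Y a n ω) (k : Fin K) {n : ℕ} (hn : T ≤ n) :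
    -(T : ℝ) - 1 - numExplore A Y n ω ≤ payoffSum A Y k n ω := by
  induction n, hn using Nat.le_induction with
  | base =>
    have h0 : 0 ≤ numExplore A Y T ω :=
      Finset.sum_nonneg fun i _ => by split_ifs <;> norm_num
    linarith [(abs_le.1 (abs_payoffSum_le (Y := Y) hG hA k T ω)).1, numPulls_le (Y := Y) k T ω]
  | succ n hn ih =>
    have h0 : 0 ≤ numExplore A Y n ω :=
      Finset.sum_nonneg fun i _ => by split_ifs <;> norm_num
    have hv := (abs_le.1 (abs_slotPayoff_le hG hA n (history Y n ω) (Y n ω))).1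
    have hS : payoffSum A Y k (n + 1) ω = payoffSum A Y k n ω
        + if (Y n ω).1 = k then slotPayoff A n (history Y n ω) (Y n ω) else 0 :=
      Finset.sum_range_succ _ _
    have hE : numExplore A Y (n + 1) ω = numExplore A Y n ω
        + @ite _ (IsLeader A (history Y n ω) (Y n ω).1) (Classical.propDecidable _) 0 1 :=
      Finset.sum_range_succ _ _
    have hT : (0 : ℝ) ≤ T := Nat.cast_nonneg T
    rw [hS, hE]
    by_cases hk : (Y n ω).1 = k
    · rw [if_pos hk]
      split_ifs with hl
      · rw [hk] at hl
        linarith [payoffSum_pos_of_isLeader hG hA (ha n hn) hl]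
      · linarith
    · rw [if_neg hk]
      split_ifs <;> linarith

theorem exists_le_wealth_of_payoffSum [MeasurableSpace 𝒳] (hG : IsTestClass G)
    (hA : IsPrediction G A) {a : Fin K} {ω : Ω} {c α : ℝ} (hc : 0 < c) (hα : 0 < α)
    (hα1 : α < 1) (ha : ∀ᶠ n : ℕ in atTop, c * n ≤ payoffSum A Y a n ω)
    (hE : ∀ δ > 0, ∀ᶠ n : ℕ in atTop, numExplore A Y n ω ≤ δ * n) :
    ∃ n, 1 ≤ n ∧ 1 / α ≤ wealth A (onsBetting A) (history Y n ω) := by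
  have hK : (0 : ℝ) < K := by exact_mod_cast a.pos
  obtain ⟨T₀, hT₀⟩ := eventually_atTop.1 ha
  set T := max T₀ 1 with hT
  have hpos : ∀ n, T ≤ n → 0 < payoffSum A Y a n ω := fun n hn => by
    have h1 : (1 : ℝ) ≤ n := by exact_mod_cast (le_max_right _ _).trans hn
    have := hT₀ n ((le_max_left _ _).trans hn)
    nlinarith
  have hlog := eventually_log_le (show 0 < c ^ 2 / 16 by positivity) (1 + Real.log (1 / α))
  have hbig := tendsto_natCast_atTop_atTop.eventually_ge_atTop (K * (T + 1) / (c / 4))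
  obtain ⟨n, ⟨⟨h1, h2⟩, h3⟩, h4⟩ :=
    (((hlog.and hbig).and (hE (c / (4 * K)) (by positivity))).and
      (eventually_ge_atTop T)).exists
  refine ⟨n, (le_max_right _ _).trans h4, ?_⟩
  have hn1 : (1 : ℝ) ≤ n := by exact_mod_cast (le_max_right _ _).trans h4
  have hSa := hT₀ n ((le_max_left _ _).trans h4)
  have hc1 : c ≤ 1 := by
    have := ((le_abs_self _).trans (abs_payoffSum_le (Y := Y) hG hA a n ω)).trans
      (numPulls_le a n ω)
    by_contra hneg
    push Not at hneg
    nlinarith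
  have hnE : 0 ≤ numExplore A Y n ω :=
    Finset.sum_nonneg fun i _ => by split_ifs <;> norm_num
  have hrest : -(K * (T + 1 + numExplore A Y n ω))
      ≤ ∑ k ∈ Finset.univ.erase a, payoffSum A Y k n ω := by
    have h5 : ∑ k ∈ (Finset.univ : Finset (Fin K)).erase a, -((T : ℝ) + 1 + numExplore A Y n ω)
        ≤ ∑ k ∈ Finset.univ.erase a, payoffSum A Y k n ω :=
      Finset.sum_le_sum fun k _ => by
        linarith [payoffSum_ge_of_leader_pos hG hA hpos k h4]
    refine le_trans ?_ h5
    rw [Finset.sum_const, nsmul_eq_mul]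
    have hcard : ((Finset.univ.erase a).card : ℝ) ≤ K := by
      have := Finset.card_le_univ (Finset.univ.erase a)
      rw [Fintype.card_fin] at this
      exact_mod_cast this
    have hTn : (0 : ℝ) ≤ T := Nat.cast_nonneg T
    nlinarith
  have hsum : c / 2 * n ≤ ∑ i ∈ Finset.range n, slotPayoff A i (history Y i ω) (Y i ω) := by
    rw [← sum_payoffSum, ← Finset.add_sum_erase _ _ (Finset.mem_univ a)]
    rw [div_le_iff₀ (by positivity)] at h2
    have h6 : K * numExplore A Y n ω ≤ c / 4 * n := by
      have := mul_le_mul_of_nonneg_left h3 hK.le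
      refine this.trans (le_of_eq ?_)
      field_simp
    nlinarith
  have hsq : ∑ i ∈ Finset.range n, slotPayoff A i (history Y i ω) (Y i ω) ^ 2 ≤ n := by
    calc _ ≤ ∑ i ∈ Finset.range n, (1 : ℝ) := Finset.sum_le_sum fun i _ => by
          rw [← sq_abs]
          exact pow_le_one₀ (abs_nonneg _) (abs_slotPayoff_le hG hA _ _ _)
      _ = n := by simp
  -- `u = c/4` maximizes `u c/2 - u²`, with value `c²/16`; this linear gain beats the logarithmic
  -- cost.
  refine le_wealth_ons hG hA (u := c / 4) hα hα1 (by rw [abs_of_pos (by positivity)]; linarith)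
    n ω ?_
  have h7 := mul_le_mul_of_nonneg_left hsum (show 0 ≤ c / 4 by positivity)
  have h8 := mul_le_mul_of_nonneg_left hsq (show 0 ≤ (c / 4) ^ 2 by positivity)
  have h9 : c / 4 * (c / 2 * n) - (c / 4) ^ 2 * n = c ^ 2 / 16 * n := by ring
  linarith

variable [MeasurableSpace 𝒳] [MeasurableSpace Ω] {μ : Measure Ω} {P Q : Fin K → Measure 𝒳}
  {π : Selection K 𝒳} {C : ℝ}

/-- The exploration mass is logarithmic, so exceeding a linear threshold has exponentially small
probability. Borel–Cantelli over the thresholds `1 / (m + 1)` keeps the null sets countable. -/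
theorem ae_numExplore_le [IsProbabilityMeasure μ] [∀ k, IsProbabilityMeasure (P k)]
    [∀ k, IsProbabilityMeasure (Q k)] [∀ n, IsMarkovKernel (π n)]
    (hA : IsPrediction G A) (hY : IsSampling μ P Q π Y) (hπ : IsEpsGreedy A C π) (hC : 0 ≤ C) :
    ∀ᵐ ω ∂μ, ∀ δ > 0, ∀ᶠ n : ℕ in atTop, numExplore A Y n ω ≤ δ * n := by
  have h : ∀ m : ℕ, ∀ᵐ ω ∂μ, ∀ᶠ n : ℕ in atTop,
      ω ∉ {ω | 1 / ((m : ℝ) + 1) * n - 2 * explorationMass C n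
        ≤ numExplore A Y n ω - 2 * explorationMass C n} := fun m => by
    refine ae_eventually_notMem_of_exp (c := 1 / (2 * ((m : ℝ) + 1)))
      (fun n => measure_numExplore_ge hA hY hπ hC n _) (by positivity) ?_
    rcases hC.eq_or_lt with rfl | hC
    · filter_upwards with n
      have h1 := explorationMass_le le_rfl n
      rw [zero_mul] at h1
      have h2 : 1 / (2 * ((m : ℝ) + 1)) * n ≤ 1 / ((m : ℝ) + 1) * n := by
        refine mul_le_mul_of_nonneg_right ?_ (Nat.cast_nonneg n)
        exact one_div_le_one_div_of_le (by positivity) (by linarith)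
      linarith
    · filter_upwards [eventually_log_le (c := 1 / (2 * ((m : ℝ) + 1)) / C) (by positivity) 2,
        eventually_ge_atTop 1] with n hn hn1
      have h1 := explorationMass_le hC.le n
      have h1n : (1 : ℝ) ≤ n := by exact_mod_cast hn1
      have h2 : Real.log n ≤ Real.log (1 + 4 * n) :=
        Real.log_le_log (by linarith) (by linarith)
      have h3 := mul_le_mul_of_nonneg_left hn hC.le
      have h4 : C * (1 / (2 * ((m : ℝ) + 1)) / C * n) = 1 / (2 * ((m : ℝ) + 1)) * n := by
        field_simp
      have h5 : 1 / ((m : ℝ) + 1) * n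
          = 1 / (2 * ((m : ℝ) + 1)) * n + 1 / (2 * ((m : ℝ) + 1)) * n := by
        field_simp
        ring
      have h6 := mul_le_mul_of_nonneg_left h2 hC.le
      linarith
  filter_upwards [ae_all_iff.2 h] with ω hω δ hδ
  obtain ⟨m, hm⟩ := exists_nat_one_div_lt hδ
  filter_upwards [hω m] with n hn
  simp only [not_le] at hn
  have := mul_le_mul_of_nonneg_right hm.le (Nat.cast_nonneg (α := ℝ) n)
  linarith

theorem ae_testSum_ge [IsProbabilityMeasure μ] [∀ k, IsProbabilityMeasure (P k)]
    [∀ k, IsProbabilityMeasure (Q k)] [∀ n, IsMarkovKernel (π n)] (hG : IsTestClass G)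
    (hne : G.Nonempty) (hY : IsSampling μ P Q π Y) (k : Fin K) :
    ∀ᵐ ω ∂μ, ∀ δ > 0, ∃ g ∈ G, ∀ᶠ n : ℕ in atTop,
      dist G (P k) (Q k) * numPulls Y k n ω - δ * n ≤ testSum g Y k n ω := by
  have h : ∀ m : ℕ, ∃ g ∈ G, ∀ᵐ ω ∂μ, ∀ᶠ n : ℕ in atTop,
      dist G (P k) (Q k) * numPulls Y k n ω - 2 / ((m : ℝ) + 1) * n ≤ testSum g Y k n ω := by
    intro m
    have hm : (0 : ℝ) < 1 / ((m : ℝ) + 1) := by positivity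
    have hm1 : 1 / ((m : ℝ) + 1) ≤ 1 := by
      rw [div_le_one (by positivity)]
      linarith [Nat.cast_nonneg (α := ℝ) m]
    set η := 1 / ((m : ℝ) + 1) with hη
    obtain ⟨g, hg, hgm⟩ := exists_integral_gt_dist_sub (R := P k) (S := Q k) hne hm
    refine ⟨g, hg, ?_⟩
    -- With `θ = η/2` the compensator `θ² N` and the threshold `η² n / 4` together cost at most `θ η
    -- n`, a deviation of `η n`; the near-maximality of `g` costs a second `η n`.
    have h1 := ae_eventually_notMem_of_exp (c := η ^ 2 / 4) (f := fun n : ℕ => η ^ 2 / 4 * n)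
      (fun n => measure_testSum_le hG hY k hg hgm.le (θ := η / 2) (by positivity) (by linarith)
        n _) (by positivity) (Eventually.of_forall fun n => le_rfl)
    filter_upwards [h1] with ω hω
    filter_upwards [hω] with n hn
    simp only [not_le] at hn
    have hN := numPulls_le (Y := Y) k n ω
    have h2 : 2 / ((m : ℝ) + 1) = 2 * η := by rw [hη]; ring
    rw [h2]
    have h3 : η / 2 * ((dist G (P k) (Q k) - η) * numPulls Y k n ω - testSum g Y k n ω)
        < η / 2 * (η * n) := by
      have := mul_le_mul_of_nonneg_left hN (show 0 ≤ (η / 2) ^ 2 by positivity)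
      nlinarith
    have h4 := lt_of_mul_lt_mul_left h3 (by positivity)
    have h5 := mul_le_mul_of_nonneg_left hN hm.le
    nlinarith
  choose g hg hgm using h
  filter_upwards [ae_all_iff.2 hgm] with ω hω δ hδ
  obtain ⟨m, hm⟩ := exists_nat_one_div_lt (show 0 < δ / 2 by positivity)
  refine ⟨g m, hg m, ?_⟩
  filter_upwards [hω m] with n hn
  have h1 : 2 / ((m : ℝ) + 1) = 2 * (1 / ((m : ℝ) + 1)) := by ring
  have := mul_le_mul_of_nonneg_right (show 2 / ((m : ℝ) + 1) ≤ δ by linarith)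
    (Nat.cast_nonneg (α := ℝ) n)
  linarith

theorem explorationConst_nonneg (K : ℕ) (L : ℝ) : 0 ≤ explorationConst K L := by
  unfold explorationConst
  positivity

theorem measure_stopTime_lt_top_eq_one [IsProbabilityMeasure μ] [∀ k, IsProbabilityMeasure (P k)]
    [∀ k, IsProbabilityMeasure (Q k)] [∀ n, IsMarkovKernel (π n)] {a : Fin K} {L α : ℝ}
    (h : IsAlternative μ G P Q a L A π Y) (hα : 0 < α) (hα1 : α < 1)
    (hR : ∀ᵐ ω ∂μ, limsup (fun t : ℕ => regret G A a (history Y t ω) / t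
      - (1 / t) * ∑ s ∈ Finset.range t,
          if (Y s ω).1 = a then dist G (P a) (Q a) else 0) atTop < 0) :
    μ {ω | stopTime A (onsBetting A) α Y ω < ⊤} = 1 := by
  have hG := h.testClass
  have hA := h.prediction
  have hne : G.Nonempty := ⟨A a 0 Fin.elim0, hA.mem a 0 Fin.elim0⟩
  have hae : ∀ᵐ ω ∂μ, stopTime A (onsBetting A) α Y ω < ⊤ := by
    filter_upwards [hR, ae_numExplore_le hA h.sampling h.greedy (explorationConst_nonneg K L),
      ae_testSum_ge hG hne h.sampling a] with ω h1 h2 h3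
    obtain ⟨b, hb1, hb2⟩ := exists_between h1
    have hD := dist_nonneg hG h.symmetric (P a) (Q a)
    -- A real limsup gives eventual bounds only for a sequence bounded above.
    have hbdd : IsBoundedUnder (· ≤ ·) atTop fun t : ℕ => regret G A a (history Y t ω) / t
        - (1 / t) * ∑ s ∈ Finset.range t,
          if (Y s ω).1 = a then dist G (P a) (Q a) else 0 := by
      refine isBoundedUnder_of ⟨2, fun t => ?_⟩
      have h4 : regret G A a (history Y t ω) / t ≤ 2 :=
        div_le_of_le_mul₀ (Nat.cast_nonneg t) (by norm_num) (regret_le hG hA a t ω)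
      have h5 : 0 ≤ (1 / (t : ℝ)) * ∑ s ∈ Finset.range t,
          if (Y s ω).1 = a then dist G (P a) (Q a) else 0 :=
        mul_nonneg (by positivity) (Finset.sum_nonneg fun i _ => by split_ifs <;> simp [hD])
      linarith
    have hev := eventually_lt_of_limsup_lt hb1 hbdd
    -- The limsup leaves a margin `-b` per slot; sampling error takes half and the payoff sum keeps
    -- the rest.
    obtain ⟨g, hg, hgt⟩ := h3 (-b / 2) (by linarith)
    obtain ⟨n, hn1, hn⟩ := exists_le_wealth_of_payoffSum (Y := Y) (a := a) hG hA (c := -b / 2)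
      (by linarith) hα hα1 (by
        filter_upwards [hev, hgt, eventually_ge_atTop 1] with n h4 h5 h6
        have hn : (0 : ℝ) < n := by exact_mod_cast h6
        have hsum : ∑ s ∈ Finset.range n, (if (Y s ω).1 = a then dist G (P a) (Q a) else 0)
            = dist G (P a) (Q a) * numPulls Y a n ω := by
          rw [numPulls, Finset.mul_sum]
          simp
        rw [hsum, one_div, inv_mul_eq_div, ← sub_div, div_lt_iff₀ hn] at h4
        linarith [testSum_sub_regret_le (Y := Y) hG hA hg a n ω]) h2
    exact (stopTime_le_of_wealth hn1 hn).trans_lt (ENat.natCast_lt_top n)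
  rw [measure_congr (eventuallyEq_univ.2 hae), measure_univ]

end ActiveTest

/-! ### Wealth from path sums, and identification of the best source -/

namespace ActiveTest

variable {K : ℕ} {𝒳 Ω : Type*} {Y : ℕ → Ω → Obs K 𝒳} {G : Set (𝒳 → ℝ)} {A : Prediction K 𝒳}

/-! ### Deterministic bounds along a sample path -/

theorem not_isLeader_of_lt {a k : Fin K} {n : ℕ} {ω : Ω} (ha : 0 < numPulls Y a n ω)
    (hk : 0 < numPulls Y k n ω)
    (h : payoffSum A Y k n ω / numPulls Y k n ω < payoffSum A Y a n ω / numPulls Y a n ω) :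
    ¬ IsLeader A (history Y n ω) k := fun hl => by
  have h1 := hl a
  rw [empMean_history_of_pos ha, empMean_history_of_pos hk, EReal.coe_le_coe_iff] at h1
  linarith

/-- After slot `s` the other sources are only selected in exploration slots. -/
theorem sub_numPulls_le {a : Fin K} {s t : ℕ} {ω : Ω}
    (h : ∀ i, s ≤ i → i < t → ∀ k, k ≠ a → ¬ IsLeader A (history Y i ω) k) :
    t - numPulls Y a t ω ≤ s + numExplore A Y t ω := by
  classical
  have h1 : (t : ℝ) - numPulls Y a t ω
      = ∑ i ∈ Finset.range t, ((1 : ℝ) - if (Y i ω).1 = a then 1 else 0) := by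
    rw [Finset.sum_sub_distrib, numPulls]
    simp
  have h2 : ∑ i ∈ Finset.range t, (if i < s then (1 : ℝ) else 0) ≤ s := by
    rw [Finset.sum_boole]
    have : (Finset.range t).filter (· < s) ⊆ Finset.range s := fun i hi => by
      simpa using (Finset.mem_filter.1 hi).2
    have := Finset.card_le_card this
    rw [Finset.card_range] at this
    exact_mod_cast this
  refine le_trans ?_ (add_le_add_left h2 _)
  rw [h1, numExplore, ← Finset.sum_add_distrib]
  refine Finset.sum_le_sum fun i hi => ?_
  have hit := Finset.mem_range.1 hi
  by_cases hia : (Y i ω).1 = a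
  · rw [if_pos hia]
    split_ifs <;> norm_num
  · rw [if_neg hia]
    by_cases his : i < s
    · rw [if_pos his]
      split_ifs <;> norm_num
    · rw [if_neg (h i (not_lt.1 his) hit _ hia)]
      split_ifs; norm_num

variable [MeasurableSpace 𝒳]

theorem payoffSum_sub_le (hG : IsTestClass G) (hA : IsPrediction G A) (a : Fin K) (t : ℕ) (ω : Ω) :
    payoffSum A Y a t ω - (t - numPulls Y a t ω)
      ≤ ∑ i ∈ Finset.range t, slotPayoff A i (history Y i ω) (Y i ω) := by
  have h1 : (t : ℝ) = ∑ _i ∈ Finset.range t, (1 : ℝ) := by simp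
  rw [payoffSum, numPulls, h1, ← Finset.sum_sub_distrib, ← Finset.sum_sub_distrib]
  refine Finset.sum_le_sum fun i _ => ?_
  have := (abs_le.1 (abs_slotPayoff_le hG hA i (history Y i ω) (Y i ω))).1
  split_ifs <;> linarith

theorem sum_sq_le (hG : IsTestClass G) (hA : IsPrediction G A) (a : Fin K) (t : ℕ) (ω : Ω) :
    ∑ i ∈ Finset.range t, slotPayoff A i (history Y i ω) (Y i ω) ^ 2
      ≤ payoffSqSum A Y a t ω + (t - numPulls Y a t ω) := by
  have h1 : (t : ℝ) = ∑ _i ∈ Finset.range t, (1 : ℝ) := by simp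
  rw [payoffSqSum, numPulls, h1, ← Finset.sum_sub_distrib, ← Finset.sum_add_distrib]
  refine Finset.sum_le_sum fun i _ => ?_
  have : slotPayoff A i (history Y i ω) (Y i ω) ^ 2 ≤ 1 := by
    rw [← sq_abs]
    exact pow_le_one₀ (abs_nonneg _) (abs_slotPayoff_le hG hA _ _ _)
  split_ifs <;> linarith

/-- With `w = 2σ² + 4D`, the bet `u = D / (4w)` maximizes `u D/2 - u² w`. The gain is `D² t / (16
w)`; one half pays for `log (1 / α)`, the other for the betting regret, where `w ≤ 6` turns 32 into
192. -/
theorem le_wealth_of_sums (hG : IsTestClass G) (hA : IsPrediction G A) {α D σ : ℝ} (hα : 0 < α)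
    (hα1 : α < 1) (hD : 0 < D) (hD1 : D ≤ 1) (hσ0 : 0 ≤ σ) (hσ : σ ≤ 1) {t : ℕ} {ω : Ω}
    (hS : D * t / 2 ≤ ∑ i ∈ Finset.range t, slotPayoff A i (history Y i ω) (Y i ω))
    (hV : ∑ i ∈ Finset.range t, slotPayoff A i (history Y i ω) (Y i ω) ^ 2
      ≤ t * (2 * σ ^ 2 + 4 * D))
    (hlog : 192 * (1 + 2 * Real.log (1 + 4 * t)) ≤ D ^ 2 * t)
    (hdet : 32 * (Real.log (1 / α) * (2 * σ ^ 2 + 4 * D)) ≤ D ^ 2 * t) :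
    1 / α ≤ wealth A (onsBetting A) (history Y t ω) := by
  set w := 2 * σ ^ 2 + 4 * D with hw
  have hw0 : 0 < w := by positivity
  have hw6 : w ≤ 6 := by nlinarith
  have hu : D / (4 * w) ≤ 1 / 2 := by
    rw [div_le_iff₀ (by positivity)]
    nlinarith [sq_nonneg σ]
  refine le_wealth_ons hG hA (u := D / (4 * w)) hα hα1
    (by rw [abs_of_pos (by positivity)]; exact hu) t ω ?_
  have h1 := mul_le_mul_of_nonneg_left hS (show 0 ≤ D / (4 * w) by positivity)
  have h2 := mul_le_mul_of_nonneg_left hV (show 0 ≤ (D / (4 * w)) ^ 2 by positivity)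
  have h3 : D / (4 * w) * (D * t / 2) - (D / (4 * w)) ^ 2 * (t * w)
      = D ^ 2 * t / (32 * w) + D ^ 2 * t / (32 * w) := by
    field_simp
    ring
  have h4 : Real.log (1 / α) ≤ D ^ 2 * t / (32 * w) := by
    rw [le_div_iff₀ (by positivity)]
    linarith
  have h5 : 1 + 2 * Real.log (1 + 4 * t) ≤ D ^ 2 * t / (32 * w) := by
    rw [le_div_iff₀ (by positivity)]
    have : 0 ≤ Real.log (1 + 4 * t) := Real.log_nonneg (by
      linarith [Nat.cast_nonneg (α := ℝ) t])
    nlinarith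
  linarith

theorem dist_add_le_of_le_gap
    {P Q : Fin K → Measure 𝒳} {a k : Fin K} {L : ℝ}
    (hL : L ≤ gap G P Q a) (hk : k ≠ a) :
    dist G (P k) (Q k) + L ≤ dist G (P a) (Q a) := by
  have h := le_ciSup (f := fun k : {k : Fin K // k ≠ a} => dist G (P k) (Q k))
    (Set.finite_range _).bddAbove ⟨k, hk⟩
  rw [gap] at hL
  simp only at h
  linarith

theorem le_dist_of_le_gap (hG : IsTestClass G) (hs : IsSymmetricClass G)
    {P Q : Fin K → Measure 𝒳} [∀ k, IsProbabilityMeasure (P k)]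
    [∀ k, IsProbabilityMeasure (Q k)] {a : Fin K} {L : ℝ}
    (hL : L ≤ gap G P Q a) : L ≤ dist G (P a) (Q a) := by
  have h : 0 ≤ ⨆ k : {k : Fin K // k ≠ a}, dist G (P k) (Q k) :=
    Real.iSup_nonneg fun k => dist_nonneg hG hs _ _
  rw [gap] at hL
  linarith

/-! ### The means are ordered after enough exploration -/

theorem explorationConst_add_one_le (hK : 1 ≤ K) {L : ℝ} (hL : 0 < L) (hL1 : L ≤ 1) :
    explorationConst K L + 1 ≤ 4000 * K ^ 2 / L ^ 2 := by
  have hK1 : (1 : ℝ) ≤ K := by exact_mod_cast hK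
  have hL2 : 1 ≤ 1 / L := by rw [le_div_iff₀ hL]; linarith
  set y := 1 / L with hy
  -- `114² = 12996` just exceeds `5 · 2580`.
  have hsq : Real.sqrt (5 * K * (2560 / L ^ 2 + 20 * K)) ≤ 114 * K * y := by
    refine Real.sqrt_le_iff.2 ⟨by positivity, ?_⟩
    have : (2560 : ℝ) / L ^ 2 = 2560 * y ^ 2 := by rw [hy]; ring
    rw [this]
    have h1 : 1 ≤ y ^ 2 := one_le_pow₀ hL2
    have h2 : 2560 * y ^ 2 + 20 * (K : ℝ) ≤ 2580 * (K * y ^ 2) := by nlinarith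
    calc 5 * (K : ℝ) * (2560 * y ^ 2 + 20 * K) ≤ 5 * K * (2580 * (K * y ^ 2)) :=
          mul_le_mul_of_nonneg_left h2 (by positivity)
      _ ≤ (114 * K * y) ^ 2 := by
          have : 0 ≤ (K : ℝ) ^ 2 * y ^ 2 := by positivity
          nlinarith
  have h3 : (4000 : ℝ) * K ^ 2 / L ^ 2 = 4000 * K ^ 2 * y ^ 2 := by rw [hy]; ring
  have h4 : (2560 : ℝ) / L ^ 2 = 2560 * y ^ 2 := by rw [hy]; ring
  rw [explorationConst, h3]
  rw [h4] at hsq ⊢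
  have h5 := mul_le_mul_of_nonneg_left hsq (show (0 : ℝ) ≤ 4 * K by positivity)
  have h6 : (K : ℝ) ≤ K ^ 2 := by nlinarith
  have h7 : y ≤ y ^ 2 := by nlinarith
  have h8 : (K : ℝ) * y ^ 2 ≤ K ^ 2 * y ^ 2 := mul_le_mul_of_nonneg_right h6 (by positivity)
  have h9 : (K : ℝ) ^ 2 * y ≤ K ^ 2 * y ^ 2 := mul_le_mul_of_nonneg_left h7 (by positivity)
  have h10 : (K : ℝ) ^ 2 ≤ K ^ 2 * y := le_mul_of_one_le_right (by positivity) hL2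
  nlinarith

/-- This part of the constant suffices: with `ℓ = log ((s + 1) / (C + 1))` it gives each source
`1280 ℓ / L²` from half its exploration share, and `640 ℓ / L²` after subtracting the allowed
deviation. -/
theorem le_explorationConst (K : ℕ) (L : ℝ) :
    2560 * K / L ^ 2 ≤ explorationConst K L := by
  have h : (2560 : ℝ) * K / L ^ 2 = K * (2560 / L ^ 2) := by ring
  rw [explorationConst, h, mul_add]
  have : 0 ≤ 4 * (K : ℝ) * Real.sqrt (5 * K * (2560 / L ^ 2 + 20 * K)) := by positivity
  have : (0 : ℝ) ≤ K * (40 * K) := by positivity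
  linarith

/-- If the sources have been explored often and their averages are accurate, then the best source
is the only leader. -/
theorem not_isLeader_of_accurate {a k : Fin K} (hG : IsTestClass G) (hA : IsPrediction G A)
    {g : 𝒳 → ℝ} (hg : g ∈ G) {D Dk L M ℓ : ℝ} (hL : 0 < L) (hDk : Dk + L ≤ D) (hℓ : 0 < ℓ)
    (hM : M ^ 2 ≤ 10 * ℓ) {s : ℕ} {ω : Ω}
    (hR : regret G A a (history Y s ω) ≤ M * Real.sqrt (numPulls Y a s ω))
    (ha : 640 * ℓ / L ^ 2 ≤ numPulls Y a s ω) (hk : 640 * ℓ / L ^ 2 ≤ numPulls Y k s ω)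
    (hTa : L / 8 * ((D - L / 16) * numPulls Y a s ω - testSum g Y a s ω)
      - (L / 8) ^ 2 * numPulls Y a s ω < 10 * ℓ)
    (hSk : L / 8 * (payoffSum A Y k s ω - Dk * numPulls Y k s ω)
      - (L / 8) ^ 2 * numPulls Y k s ω < 10 * ℓ) :
    ¬ IsLeader A (history Y s ω) k := by
  have hpos : 0 < 640 * ℓ / L ^ 2 := by positivity
  have hNa := hpos.trans_le ha
  have hNk := hpos.trans_le hk
  refine not_isLeader_of_lt hNa hNk ?_
  rw [div_le_iff₀ (by positivity)] at ha hk
  -- With `N ≥ 640 ℓ / L²` pulls, `10 ℓ ≤ (L/8)² N`, so each noise term is at most `L/4` per pull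
  -- and the regret at most `L/8`. The average of `k` is below `D - 3L/4`, that of `a` at least `D -
  -- 7L/16`.
  have h1 : payoffSum A Y k s ω < (Dk + L / 4) * numPulls Y k s ω := by
    have : L / 8 * payoffSum A Y k s ω < L / 8 * ((Dk + L / 4) * numPulls Y k s ω) := by nlinarith
    exact lt_of_mul_lt_mul_left this (by positivity)
  have h2 : (D - 5 * L / 16) * numPulls Y a s ω < testSum g Y a s ω := by
    have : L / 8 * ((D - 5 * L / 16) * numPulls Y a s ω) < L / 8 * testSum g Y a s ω := by
      nlinarith
    exact lt_of_mul_lt_mul_left this (by positivity)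
  have h3 : M * Real.sqrt (numPulls Y a s ω) ≤ L / 8 * numPulls Y a s ω := by
    set q := Real.sqrt (numPulls Y a s ω) with hq
    have hq0 : 0 ≤ q := Real.sqrt_nonneg _
    have hqq : numPulls Y a s ω = q ^ 2 := (Real.sq_sqrt hNa.le).symm
    have h4 : M ≤ L / 8 * q := by
      refine le_of_sq_le_sq ?_ (by positivity)
      rw [hqq] at ha
      nlinarith
    rw [hqq]
    nlinarith
  have h4 := testSum_sub_regret_le (Y := Y) hG hA hg a s ω
  calc payoffSum A Y k s ω / numPulls Y k s ω < Dk + L / 4 := (div_lt_iff₀ hNk).2 h1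
    _ ≤ D - 7 * L / 16 := by linarith
    _ ≤ payoffSum A Y a s ω / numPulls Y a s ω := by
      rw [le_div_iff₀ hNa]
      nlinarith

variable [MeasurableSpace Ω] {μ : Measure Ω} {P Q : Fin K → Measure 𝒳} {π : Selection K 𝒳}

/-- A wrong leader together with small regret forces one of `2K + 1 ≤ 3K` noise events: some source
underexplored (`B₁`), some payoff sum too large (`B₂`), or the near-maximizer doing badly on `a`
(`B₃`). -/
theorem measure_exists_isLeader_le [IsProbabilityMeasure μ] [∀ k, IsProbabilityMeasure (P k)]
    [∀ k, IsProbabilityMeasure (Q k)] [∀ n, IsMarkovKernel (π n)] {a : Fin K} {L M : ℝ}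
    (h : IsAlternative μ G P Q a L A π Y) (hL1 : L ≤ 1) {s : ℕ}
    (hℓ : 0 < Real.log ((s + 1) / (explorationConst K L + 1)))
    (hM : M ^ 2 ≤ 10 * Real.log ((s + 1) / (explorationConst K L + 1))) :
    μ {ω | regret G A a (history Y s ω) ≤ M * Real.sqrt (numPulls Y a s ω)
        ∧ ∃ k, k ≠ a ∧ IsLeader A (history Y s ω) k}
      ≤ ENNReal.ofReal (3 * K
        * Real.exp (-(10 * Real.log ((s + 1) / (explorationConst K L + 1))))) := by
  have hG := h.testClass
  have hA := h.prediction
  have hL := h.L_pos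
  have hK : 1 ≤ K := a.pos
  have hK1 : (1 : ℝ) ≤ K := by exact_mod_cast hK
  have hC : 0 < explorationConst K L :=
    lt_of_lt_of_le (by positivity) (le_explorationConst K L)
  set C := explorationConst K L with hCdef
  set ℓ := Real.log ((s + 1) / (C + 1)) with hℓdef
  obtain ⟨g, hg, hgm⟩ := exists_integral_gt_dist_sub (R := P a) (S := Q a) (G := G)
    ⟨A a 0 Fin.elim0, hA.mem a 0 Fin.elim0⟩ (show 0 < L / 16 by positivity)
  set D := dist G (P a) (Q a) with hD
  let B₁ : Fin K → Set Ω := fun k =>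
    {ω | 10 * ℓ / L ^ 2 * 64 ≤ explorationMass C s / (2 * K) - numPulls Y k s ω}
  let B₂ : Fin K → Set Ω := fun k =>
    {ω | 10 * ℓ ≤ L / 8 * (payoffSum A Y k s ω - dist G (P k) (Q k) * numPulls Y k s ω)
        - (L / 8) ^ 2 * numPulls Y k s ω}
  let B₃ : Set Ω := {ω | 10 * ℓ ≤ L / 8 * ((D - L / 16) * numPulls Y a s ω - testSum g Y a s ω)
        - (L / 8) ^ 2 * numPulls Y a s ω}
  have hmass : 1280 * ℓ / L ^ 2 ≤ explorationMass C s / (2 * K) := by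
    rw [le_div_iff₀ (by positivity)]
    refine le_trans ?_ (le_explorationMass hC s)
    refine le_trans (le_of_eq ?_) (mul_le_mul_of_nonneg_right (le_explorationConst K L) hℓ.le)
    ring
  have hsub : {ω | regret G A a (history Y s ω) ≤ M * Real.sqrt (numPulls Y a s ω)
        ∧ ∃ k, k ≠ a ∧ IsLeader A (history Y s ω) k} ⊆ (⋃ k, B₁ k) ∪ (⋃ k, B₂ k) ∪ B₃ := by
    rintro ω ⟨hR, k, hka, hk⟩
    by_contra hno
    simp only [B₁, B₂, B₃, Set.mem_union, Set.mem_iUnion, Set.mem_ofPred_eq, not_or, not_exists,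
      not_le] at hno
    obtain ⟨⟨h1, h2⟩, h3⟩ := hno
    have hN : ∀ k, 640 * ℓ / L ^ 2 ≤ numPulls Y k s ω := fun k => by
      have := h1 k
      have e1 : 10 * ℓ / L ^ 2 * 64 = 640 * ℓ / L ^ 2 := by ring
      have e2 : 1280 * ℓ / L ^ 2 = 640 * ℓ / L ^ 2 + 640 * ℓ / L ^ 2 := by ring
      linarith
    exact not_isLeader_of_accurate hG hA hg hL (dist_add_le_of_le_gap h.L_le_gap hka) hℓ hM hR
      (hN a) (hN k) h3 (h2 k) hk
  have hB₁ : ∀ k, μ (B₁ k) ≤ ENNReal.ofReal (Real.exp (-(10 * ℓ))) := fun k => by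
    refine (measure_numPulls_le h.sampling h.greedy k s _).trans (ENNReal.ofReal_le_ofReal ?_)
    refine Real.exp_le_exp.2 (neg_le_neg ?_)
    have : 10 * ℓ ≤ 10 * ℓ / L ^ 2 := by
      rw [le_div_iff₀ (by positivity)]
      exact mul_le_of_le_one_right (by positivity) (pow_le_one₀ hL.le hL1)
    nlinarith
  have hB₂ : ∀ k, μ (B₂ k) ≤ ENNReal.ofReal (Real.exp (-(10 * ℓ))) := fun k =>
    measure_payoffSum_ge hG hA h.sampling k (by positivity) (by linarith) s _
  have hB₃ : μ B₃ ≤ ENNReal.ofReal (Real.exp (-(10 * ℓ))) :=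
    measure_testSum_le hG h.sampling a hg hgm.le (by positivity) (by linarith) s _
  set e := Real.exp (-(10 * ℓ)) with he
  have he0 : 0 ≤ e := (Real.exp_pos _).le
  have hU : ∀ B : Fin K → Set Ω, (∀ k, μ (B k) ≤ ENNReal.ofReal e) →
      μ (⋃ k, B k) ≤ ENNReal.ofReal (K * e) := fun B hB => by
    refine (measure_iUnion_fintype_le μ B).trans ((Finset.sum_le_sum fun k _ => hB k).trans ?_)
    rw [Finset.sum_const, Finset.card_univ, Fintype.card_fin, nsmul_eq_mul,
      ENNReal.ofReal_mul (by positivity), ENNReal.ofReal_natCast]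
  calc _ ≤ μ ((⋃ k, B₁ k) ∪ (⋃ k, B₂ k) ∪ B₃) := measure_mono hsub
    _ ≤ ENNReal.ofReal (K * e) + ENNReal.ofReal (K * e) + ENNReal.ofReal e :=
        (measure_union_le _ _).trans (add_le_add ((measure_union_le _ _).trans
          (add_le_add (hU _ hB₁) (hU _ hB₂))) hB₃)
    _ = ENNReal.ofReal (K * e + K * e + e) := by
        rw [ENNReal.ofReal_add (by positivity) he0, ENNReal.ofReal_add (by positivity)
          (by positivity)]
    _ ≤ ENNReal.ofReal (3 * K * e) := ENNReal.ofReal_le_ofReal (by nlinarith)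

end ActiveTest

/-! ### Calculus of the horizon and the failure event at time `t` -/

namespace ActiveTest

/-! ### The failure probability at a late time -/

/-- The exploration phase lasts for `K ^ 3 / L ^ 6` times the sixth power of this constant. -/
noncomputable def horizonScale (M : ℝ) : ℝ := 1000 * Real.exp (M ^ 2)

theorem thousand_le_horizonScale (M : ℝ) : 1000 ≤ horizonScale M := by
  have := Real.one_le_exp (sq_nonneg M)
  rw [horizonScale]
  linarith

theorem abs_le_horizonScale (M : ℝ) : 16 * |M| ≤ horizonScale M := by
  have h1 := Real.add_one_le_exp (M ^ 2)
  have h2 := sq_abs M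
  rw [horizonScale]
  nlinarith [sq_nonneg (|M| - 1), abs_nonneg M]

/-- The divisor is `64 · 4000`: 64 from the starting slot `Lt/64`, 4000 from
`explorationConst_add_one_le`. -/
theorem exp_sq_le_horizonScale (M : ℝ) : Real.exp (M ^ 2) ≤ horizonScale M ^ 4 / 256000 := by
  have h1 := Real.one_le_exp (sq_nonneg M)
  have h2 : Real.exp (M ^ 2) ≤ Real.exp (M ^ 2) ^ 4 := le_self_pow₀ h1 (by norm_num)
  rw [horizonScale, mul_pow]
  linarith

section Horizon

variable {K : ℕ} {L M x : ℝ}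

/-- Here `x` plays the role of the sixth root of `t`, and `hm` says `t ≥ m⁶ K³ / L⁶` with `m` the
scale. Logarithms of `t` become at most linear in `x`, so no logarithm of `K / L` enters the
horizon. -/
theorem horizonScale_le (hK : 1 ≤ K) (hL : 0 < L) (hx : 0 < x)
    (hm : horizonScale M ^ 2 * K ≤ x ^ 2 * L ^ 2) : horizonScale M ≤ x * L := by
  have hK1 : (1 : ℝ) ≤ K := by exact_mod_cast hK
  refine le_of_sq_le_sq ?_ (by positivity)
  rw [mul_pow]
  exact (le_mul_of_one_le_right (sq_nonneg _) hK1).trans hm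

theorem horizonScale_le_self (hK : 1 ≤ K) (hL : 0 < L) (hL1 : L ≤ 1) (hx : 0 < x)
    (hm : horizonScale M ^ 2 * K ≤ x ^ 2 * L ^ 2) : horizonScale M ≤ x :=
  (horizonScale_le hK hL hx hm).trans (mul_le_of_le_one_right hx.le hL1)

theorem explorationConst_mul_le (hK : 1 ≤ K) (hL : 0 < L) (hL1 : L ≤ 1)
    (hm : horizonScale M ^ 2 * K ≤ x ^ 2 * L ^ 2) :
    (explorationConst K L + 1) * (horizonScale M ^ 4 / 256000) ≤ L / 64 * x ^ 4 := by
  have h1 := explorationConst_add_one_le hK hL hL1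
  rw [le_div_iff₀ (by positivity)] at h1
  have h2 : (horizonScale M ^ 2 * K) ^ 2 ≤ (x ^ 2 * L ^ 2) ^ 2 :=
    pow_le_pow_left₀ (by positivity) hm 2
  have h3 : (explorationConst K L + 1) * horizonScale M ^ 4 * L ^ 2 ≤ 4000 * x ^ 4 * L ^ 2 * L := by
    calc (explorationConst K L + 1) * horizonScale M ^ 4 * L ^ 2
        = (explorationConst K L + 1) * L ^ 2 * horizonScale M ^ 4 := by ring
      _ ≤ 4000 * K ^ 2 * horizonScale M ^ 4 := mul_le_mul_of_nonneg_right h1 (by positivity)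
      _ = 4000 * (horizonScale M ^ 2 * K) ^ 2 := by ring
      _ ≤ 4000 * (x ^ 2 * L ^ 2) ^ 2 := by linarith
      _ = 4000 * x ^ 4 * L ^ 2 * (L * L) := by ring
      _ ≤ 4000 * x ^ 4 * L ^ 2 * L :=
          mul_le_mul_of_nonneg_left (mul_le_of_le_one_right hL.le hL1) (by positivity)
  have h4 : (explorationConst K L + 1) * horizonScale M ^ 4 ≤ 4000 * x ^ 4 * L := by
    refine le_of_mul_le_mul_right (a := L ^ 2) ?_ (by positivity)
    calc _ ≤ _ := h3
      _ = 4000 * x ^ 4 * L * L ^ 2 := by ring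
  linarith

/-- After the time `x ^ 6` the sampling noise is small. -/
theorem twelve_mul_le (hK : 1 ≤ K) (hL : 0 < L) (hL1 : L ≤ 1) (hx : 0 < x)
    (hm : horizonScale M ^ 2 * K ≤ x ^ 2 * L ^ 2) : 12 * x ≤ L ^ 2 * x ^ 6 / 256 := by
  have h1 := horizonScale_le hK hL hx hm
  have h2 := horizonScale_le_self hK hL hL1 hx hm
  have h3 := thousand_le_horizonScale M
  have h4 : (1000 : ℝ) ^ 2 ≤ (x * L) ^ 2 := pow_le_pow_left₀ (by norm_num) (h3.trans h1) 2
  have h5 : x ≤ x ^ 4 := le_self_pow₀ (by linarith) (by norm_num)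
  have h6 : L ^ 2 * x ^ 6 = (x * L) ^ 2 * x ^ 4 := by ring
  rw [h6]
  nlinarith

theorem mul_log_le (hK : 1 ≤ K) (hL : 0 < L) (hL1 : L ≤ 1) (hx : 0 < x)
    (hm : horizonScale M ^ 2 * K ≤ x ^ 2 * L ^ 2) :
    192 * (1 + 2 * Real.log (1 + 4 * x ^ 6)) ≤ L ^ 2 * x ^ 6 := by
  have h1 := horizonScale_le hK hL hx hm
  have h2 := horizonScale_le_self hK hL hL1 hx hm
  have h3 := thousand_le_horizonScale M
  have h4 : (1000 : ℝ) ^ 2 ≤ (x * L) ^ 2 := pow_le_pow_left₀ (by norm_num) (h3.trans h1) 2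
  have h5 : x ≤ x ^ 4 := le_self_pow₀ (by linarith) (by norm_num)
  have h6 : L ^ 2 * x ^ 6 = (x * L) ^ 2 * x ^ 4 := by ring
  have h7 : Real.log (1 + 4 * x ^ 6) ≤ 4 + 6 * x := by
    have h8 : 1 + 4 * x ^ 6 ≤ 5 * x ^ 6 := by
      have : 1 ≤ x ^ 6 := one_le_pow₀ (by linarith)
      linarith
    have h9 := Real.log_le_log (by positivity) h8
    rw [Real.log_mul (by norm_num) (by positivity), Real.log_pow] at h9
    have h10 := Real.log_le_sub_one_of_pos hx
    have h11 := Real.log_le_sub_one_of_pos (show (0 : ℝ) < 5 by norm_num)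
    push_cast at h9
    linarith
  rw [h6]
  nlinarith

theorem two_mul_explorationMass_le (hK : 1 ≤ K) (hL : 0 < L) (hL1 : L ≤ 1) (hx : 0 < x)
    (hm : horizonScale M ^ 2 * K ≤ x ^ 2 * L ^ 2) {t : ℕ} (ht : x ^ 6 = t) :
    2 * explorationMass (explorationConst K L) t ≤ L / 64 * t := by
  have h2 := horizonScale_le_self hK hL hL1 hx hm
  have h3 := thousand_le_horizonScale M
  have hC := explorationConst_nonneg K L
  have h4 := explorationConst_mul_le hK hL hL1 hm
  have h5 : (12 : ℝ) ≤ horizonScale M ^ 4 / 256000 := by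
    have : (1000 : ℝ) ^ 4 ≤ horizonScale M ^ 4 := pow_le_pow_left₀ (by norm_num) h3 4
    linarith
  have h6 := explorationMass_le hC t
  have h7 : 1 + Real.log t ≤ 6 * x := by
    rw [← ht, Real.log_pow]
    have := Real.log_le_sub_one_of_pos hx
    push_cast
    linarith
  have h8 : explorationConst K L * 12 ≤ L / 64 * x ^ 4 := by nlinarith
  calc 2 * explorationMass (explorationConst K L) t
      ≤ 2 * (explorationConst K L * (6 * x)) := by
        have := mul_le_mul_of_nonneg_left h7 hC
        linarith
    _ = explorationConst K L * 12 * x := by ring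
    _ ≤ L / 64 * x ^ 4 * x := mul_le_mul_of_nonneg_right h8 hx.le
    _ = L / 64 * x ^ 5 := by ring
    _ ≤ L / 64 * x ^ 6 := mul_le_mul_of_nonneg_left
        (pow_le_pow_right₀ (by linarith) (by norm_num)) (by positivity)
    _ = L / 64 * t := by rw [ht]

/-- The part `M²` lets the averages absorb the prediction regret; the part `log (x²)` makes the
failure probability polynomially small. -/
theorem le_log_explored (hK : 1 ≤ K) (hL : 0 < L) (hL1 : L ≤ 1) (hx : 0 < x)
    (hm : horizonScale M ^ 2 * K ≤ x ^ 2 * L ^ 2) {s : ℕ} (hs : L / 64 * x ^ 6 ≤ s) :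
    M ^ 2 + Real.log (x ^ 2) ≤ Real.log ((s + 1) / (explorationConst K L + 1)) := by
  have hC := explorationConst_nonneg K L
  rw [Real.le_log_iff_exp_le (by positivity), Real.exp_add, Real.exp_log (by positivity),
    le_div_iff₀ (by positivity)]
  calc Real.exp (M ^ 2) * x ^ 2 * (explorationConst K L + 1)
      ≤ horizonScale M ^ 4 / 256000 * x ^ 2 * (explorationConst K L + 1) := by
        have := exp_sq_le_horizonScale M
        gcongr
    _ = (explorationConst K L + 1) * (horizonScale M ^ 4 / 256000) * x ^ 2 := by ring
    _ ≤ L / 64 * x ^ 4 * x ^ 2 :=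
        mul_le_mul_of_nonneg_right (explorationConst_mul_le hK hL hL1 hm) (by positivity)
    _ = L / 64 * x ^ 6 := by ring
    _ ≤ s + 1 := by linarith

theorem exp_neg_twelve_mul_le (hx : 0 < x) {y : ℝ} (hy : 12 * x ≤ y) :
    Real.exp (-y) ≤ 1 / x ^ 12 := by
  have h1 : Real.log (x ^ 12) ≤ y := by
    rw [Real.log_pow]
    have := Real.log_le_sub_one_of_pos hx
    push_cast
    linarith
  rw [Real.exp_neg, one_div]
  exact inv_anti₀ (by positivity) ((Real.log_le_iff_le_exp (by positivity)).1 h1)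

end Horizon

variable {K : ℕ} {𝒳 Ω : Type*} {Y : ℕ → Ω → Obs K 𝒳} {G : Set (𝒳 → ℝ)} {A : Prediction K 𝒳}
  [MeasurableSpace 𝒳] [MeasurableSpace Ω] {μ : Measure Ω} {P Q : Fin K → Measure 𝒳}
  {π : Selection K 𝒳}

/-- Each slot fails with probability at most `3K x⁻²⁰ ≤ x⁻¹⁸`, and there are `t = x⁶` slots. -/
theorem measure_exists_isLeader_horizon_le [IsProbabilityMeasure μ]
    [∀ k, IsProbabilityMeasure (P k)] [∀ k, IsProbabilityMeasure (Q k)]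
    [∀ n, IsMarkovKernel (π n)] {a : Fin K} {L M x : ℝ}
    (h : IsAlternative μ G P Q a L A π Y) (hL1 : L ≤ 1) (hx : 0 < x)
    (hm : horizonScale M ^ 2 * K ≤ x ^ 2 * L ^ 2) {t : ℕ} (ht : x ^ 6 = t) :
    μ {ω | ∃ s < t, L / 64 * t ≤ s
        ∧ regret G A a (history Y s ω) ≤ M * Real.sqrt (numPulls Y a s ω)
        ∧ ∃ k, k ≠ a ∧ IsLeader A (history Y s ω) k} ≤ ENNReal.ofReal (1 / x ^ 12) := by
  have hK : 1 ≤ K := a.pos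
  have hL := h.L_pos
  have hx1000 := (thousand_le_horizonScale M).trans (horizonScale_le_self hK hL hL1 hx hm)
  have hx2 : 0 < Real.log (x ^ 2) := Real.log_pos (one_lt_pow₀ (by linarith) (by norm_num))
  have hKx : 3 * (K : ℝ) ≤ x ^ 2 := by
    have h1 : (1000 : ℝ) ^ 2 ≤ horizonScale M ^ 2 :=
      pow_le_pow_left₀ (by norm_num) (thousand_le_horizonScale M) 2
    have h2 : x ^ 2 * L ^ 2 ≤ x ^ 2 :=
      mul_le_of_le_one_right (sq_nonneg _) (pow_le_one₀ hL.le hL1)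
    have h3 : (0 : ℝ) ≤ K := Nat.cast_nonneg K
    nlinarith
  let B : ℕ → Set Ω := fun s => {ω | L / 64 * t ≤ s
        ∧ regret G A a (history Y s ω) ≤ M * Real.sqrt (numPulls Y a s ω)
        ∧ ∃ k, k ≠ a ∧ IsLeader A (history Y s ω) k}
  have hB : ∀ s, μ (B s) ≤ ENNReal.ofReal (1 / x ^ 18) := fun s => by
    by_cases hs : L / 64 * t ≤ s
    · have hℓ := le_log_explored (M := M) hK hL hL1 hx hm (s := s) (by rw [ht]; exact hs)
      set ℓ := Real.log ((s + 1) / (explorationConst K L + 1)) with hℓdef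
      have hM2 := sq_nonneg M
      have h1 := measure_exists_isLeader_le (M := M) h hL1 (s := s)
        (by rw [← hℓdef]; linarith) (by rw [← hℓdef]; linarith)
      refine (measure_mono fun ω hω => hω.2).trans (h1.trans (ENNReal.ofReal_le_ofReal ?_))
      rw [← hℓdef]
      have h2 : Real.exp (-(10 * ℓ)) ≤ 1 / x ^ 20 := by
        have h3 : Real.log (x ^ 20) ≤ 10 * ℓ := by
          rw [show x ^ 20 = (x ^ 2) ^ 10 by ring, Real.log_pow]
          push_cast
          linarith
        rw [Real.exp_neg, one_div]
        exact inv_anti₀ (by positivity) ((Real.log_le_iff_le_exp (by positivity)).1 h3)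
      calc 3 * K * Real.exp (-(10 * ℓ)) ≤ x ^ 2 * (1 / x ^ 20) :=
            mul_le_mul hKx h2 (Real.exp_pos _).le (sq_nonneg _)
        _ = 1 / x ^ 18 := by field_simp
    · have : B s = ∅ := by
        ext ω
        simp [B, hs]
      rw [this]
      simp
  have hsub : {ω | ∃ s < t, L / 64 * t ≤ s
        ∧ regret G A a (history Y s ω) ≤ M * Real.sqrt (numPulls Y a s ω)
        ∧ ∃ k, k ≠ a ∧ IsLeader A (history Y s ω) k} ⊆ ⋃ s ∈ Finset.range t, B s := by
    rintro ω ⟨s, hs, h1⟩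
    simp only [Set.mem_iUnion, Finset.mem_range]
    exact ⟨s, hs, h1⟩
  refine (measure_mono hsub).trans ((measure_biUnion_finset_le _ _).trans
    ((Finset.sum_le_sum fun s _ => hB s).trans ?_))
  rw [Finset.sum_const, Finset.card_range, nsmul_eq_mul, ← ENNReal.ofReal_natCast,
    ← ENNReal.ofReal_mul (Nat.cast_nonneg t), ← ht]
  refine ENNReal.ofReal_le_ofReal (le_of_eq ?_)
  field_simp

/-- Outside an event of small probability the payoffs have a large sum and a small sum of
squares. -/
theorem exists_bad_set [IsProbabilityMeasure μ]
    [∀ k, IsProbabilityMeasure (P k)] [∀ k, IsProbabilityMeasure (Q k)]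
    [∀ n, IsMarkovKernel (π n)] {a : Fin K} {L M x : ℝ}
    (h : IsAlternative μ G P Q a L A π Y) (hx : 0 < x)
    (hm : horizonScale M ^ 2 * K ≤ x ^ 2 * L ^ 2) {t : ℕ} (ht : x ^ 6 = t) :
    ∃ B : Set Ω, μ B ≤ ENNReal.ofReal (4 / (t : ℝ) ^ 2) ∧ ∀ ω ∉ B,
      (∀ s : ℕ, regret G A a (history Y s ω)
        ≤ M * Real.sqrt (count a (history Y s ω))) →
      dist G (P a) (Q a) * t / 2
        ≤ ∑ i ∈ Finset.range t, slotPayoff A i (history Y i ω) (Y i ω) ∧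
      ∑ i ∈ Finset.range t, slotPayoff A i (history Y i ω) (Y i ω) ^ 2
        ≤ t * (2 * stdev G (P a) (Q a) ^ 2 + 4 * dist G (P a) (Q a)) := by
  have hG := h.testClass
  have hA := h.prediction
  have hL := h.L_pos
  have hK : 1 ≤ K := a.pos
  have hD1 := dist_le_one hG (P a) (Q a)
  have hLD := le_dist_of_le_gap hG h.symmetric h.L_le_gap
  have hσ1 := stdev_le_one hG (P a) (Q a)
  have hσ0 := stdev_nonneg (G := G) (P a) (Q a)
  obtain ⟨g, hg, hgm⟩ := exists_integral_gt_dist_sub (R := P a) (S := Q a) (G := G)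
    ⟨A a 0 Fin.elim0, hA.mem a 0 Fin.elim0⟩ (show 0 < L / 16 by positivity)
  set D := dist G (P a) (Q a) with hD
  set σ := stdev G (P a) (Q a) with hσ
  have hL1 : L ≤ 1 := hLD.trans hD1
  have hnoise := twelve_mul_le hK hL hL1 hx hm
  have hmass := two_mul_explorationMass_le hK hL hL1 hx hm ht
  have hxL := horizonScale_le hK hL hx hm
  have hxm := horizonScale_le_self hK hL hL1 hx hm
  have hm1000 := thousand_le_horizonScale M
  have hC := explorationConst_nonneg K L
  set C := explorationConst K L with hCdef
  rw [ht] at hnoise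
  have ht0 : (0 : ℝ) ≤ t := Nat.cast_nonneg t
  have hLL : L ^ 2 * t ≤ L * t := by nlinarith [mul_nonneg hL.le ht0]
  have hone : 1 ≤ L / 64 * t := by nlinarith
  let B₁ : Set Ω := {ω | ∃ s < t, L / 64 * t ≤ s
        ∧ regret G A a (history Y s ω) ≤ M * Real.sqrt (numPulls Y a s ω)
        ∧ ∃ k, k ≠ a ∧ IsLeader A (history Y s ω) k}
  let B₂ : Set Ω := {ω | L / 64 * t ≤ numExplore A Y t ω - 2 * explorationMass C t}
  let B₃ : Set Ω := {ω | L ^ 2 * t / 256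
    ≤ L / 16 * ((D - L / 16) * numPulls Y a t ω - testSum g Y a t ω)
        - (L / 16) ^ 2 * numPulls Y a t ω}
  let B₄ : Set Ω := {ω | L * t ≤ payoffSqSum A Y a t ω
    - 2 * (σ ^ 2 + D ^ 2) * numPulls Y a t ω}
  have hexp : ∀ y : ℝ, 12 * x ≤ y → ENNReal.ofReal (Real.exp (-y)) ≤ ENNReal.ofReal (1 / x ^ 12) :=
    fun y hy => ENNReal.ofReal_le_ofReal (exp_neg_twelve_mul_le hx hy)
  have hB₁ : μ B₁ ≤ ENNReal.ofReal (1 / x ^ 12) :=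
    measure_exists_isLeader_horizon_le h hL1 hx hm ht
  have hB₂ : μ B₂ ≤ ENNReal.ofReal (1 / x ^ 12) :=
    (measure_numExplore_ge hA h.sampling h.greedy hC t _).trans (hexp _ (by linarith))
  have hB₃ : μ B₃ ≤ ENNReal.ofReal (1 / x ^ 12) :=
    (measure_testSum_le hG h.sampling a hg hgm.le (by positivity) (by linarith) t _).trans
      (hexp _ hnoise)
  have hB₄ : μ B₄ ≤ ENNReal.ofReal (1 / x ^ 12) :=
    (measure_payoffSqSum_ge hG h.symmetric hA h.sampling a t _).trans (hexp _ (by linarith))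
  refine ⟨B₁ ∪ B₂ ∪ B₃ ∪ B₄, ?_, fun ω hω hR => ?_⟩
  · have hp : (0 : ℝ) ≤ 1 / x ^ 12 := by positivity
    calc μ (B₁ ∪ B₂ ∪ B₃ ∪ B₄)
        ≤ ENNReal.ofReal (1 / x ^ 12) + ENNReal.ofReal (1 / x ^ 12)
          + ENNReal.ofReal (1 / x ^ 12) + ENNReal.ofReal (1 / x ^ 12) :=
          (measure_union_le _ _).trans (add_le_add ((measure_union_le _ _).trans
            (add_le_add ((measure_union_le _ _).trans (add_le_add hB₁ hB₂)) hB₃)) hB₄)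
      _ = ENNReal.ofReal (4 / (t : ℝ) ^ 2) := by
          rw [← ENNReal.ofReal_add hp hp, ← ENNReal.ofReal_add (by positivity) hp,
            ← ENNReal.ofReal_add (by positivity) hp, ← ht]
          congr 1
          ring
  simp only [B₁, B₂, B₃, B₄, Set.mem_union, Set.mem_ofPred_eq, not_or, not_le] at hω
  obtain ⟨⟨⟨h1, h2⟩, h3⟩, h4⟩ := hω
  simp_rw [count_history] at hR
  have hlead : ∀ i, ⌈L / 64 * (t : ℝ)⌉₊ ≤ i → i < t → ∀ k, k ≠ a
      → ¬ IsLeader A (history Y i ω) k := fun i hi hit k hk hl =>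
    h1 ⟨i, hit, (Nat.le_ceil _).trans (by exact_mod_cast hi), hR i, k, hk, hl⟩
  have hother := sub_numPulls_le hlead
  have hceil := (Nat.ceil_lt_add_one (show 0 ≤ L / 64 * (t : ℝ) by positivity)).le
  have hNt := numPulls_le (Y := Y) a t ω
  have hN0 := numPulls_nonneg (Y := Y) a t ω
  set N := numPulls Y a t ω with hN
  -- Four shares of `Lt/64`: the initial slots, the rounding up, twice the exploration mass, and its
  -- deviation.
  have hother' : t - N ≤ L / 16 * t := by linarith
  constructor
  · refine le_trans ?_ (payoffSum_sub_le hG hA a t ω)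
    have hreg : regret G A a (history Y t ω) ≤ L / 16 * t := by
      have hsq : Real.sqrt N ≤ x ^ 3 := by
        refine Real.sqrt_le_iff.2 ⟨by positivity, hNt.trans (le_of_eq ?_)⟩
        rw [← ht]; ring
      have hMm := abs_le_horizonScale M
      have hx1 : 1 ≤ x := by linarith
      calc regret G A a (history Y t ω) ≤ M * Real.sqrt N := hR t
        _ ≤ |M| * x ^ 3 := mul_le_mul (le_abs_self M) hsq (Real.sqrt_nonneg _) (abs_nonneg M)
        _ ≤ x * L / 16 * x ^ 5 := mul_le_mul (by linarith)
            (pow_le_pow_right₀ hx1 (by norm_num)) (by positivity) (by positivity)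
        _ = L / 16 * t := by rw [← ht]; ring
    have hS := testSum_sub_regret_le (Y := Y) hG hA hg a t ω
    have hT : (D - L / 8) * N - L / 16 * t ≤ testSum g Y a t ω := by
      have : L / 16 * ((D - L / 8) * N - L / 16 * t) ≤ L / 16 * testSum g Y a t ω := by nlinarith
      exact le_of_mul_le_mul_left this (by positivity)
    rw [← hN]
    -- The losses add up to `L t (1/8 + 4/16) = 3Lt/8`: the deviation per pull, then the constant
    -- deviation, the regret, the other slots, and replacing `N` by `t`. Since `L ≤ D`, more than `D
    -- t / 2` remains.
    have e1 : D * (t - N) ≤ t - N := mul_le_of_le_one_left (by linarith) hD1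
    have e2 := mul_le_mul_of_nonneg_left hNt hL.le
    have e3 := mul_le_mul_of_nonneg_right hLD ht0
    linarith
  · refine (sum_sq_le hG hA a t ω).trans ?_
    rw [← hN]
    have e1 := mul_le_mul_of_nonneg_left hNt (show 0 ≤ 2 * (σ ^ 2 + D ^ 2) by positivity)
    have e2 := mul_le_mul_of_nonneg_right hLD ht0
    have e3 : D ^ 2 ≤ D := by nlinarith
    have e4 := mul_le_mul_of_nonneg_right e3 ht0
    linarith

end ActiveTest

/-! ### From failure probabilities to the expected stopping time -/

namespace ActiveTest

/-! ### The expected stopping time -/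

/-- `X` exceeds `T` by at most the length of the initial run of bad indices, hence by at most the
number of all bad indices. Measurable hulls replace the `B n`, which need not be measurable. -/
theorem lintegral_enat_le {Ω : Type*} [MeasurableSpace Ω] {μ : Measure Ω}
    [IsProbabilityMeasure μ] {X : Ω → ℕ∞} {B : ℕ → Set Ω} (T : ℕ)
    (h : ∀ᵐ ω ∂μ, ∀ n, T ≤ n → ω ∉ B n → X ω ≤ n) :
    ∫⁻ ω, (X ω : ℝ≥0∞) ∂μ ≤ T + ∑' i, μ (B (T + i)) := by
  have hpt : ∀ᵐ ω ∂μ, (X ω : ℝ≥0∞)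
      ≤ T + ∑' i, (toMeasurable μ (B (T + i))).indicator (1 : Ω → ℝ≥0∞) ω := by
    filter_upwards [h] with ω hω
    by_cases hex : ∃ j, ω ∉ B (T + j)
    · classical
      have hmin : ∀ i < Nat.find hex, ω ∈ B (T + i) := fun i hi => not_not.1 (Nat.find_min hex hi)
      have hX := hω _ (Nat.le_add_right T (Nat.find hex)) (Nat.find_spec hex)
      calc (X ω : ℝ≥0∞) ≤ (((T + Nat.find hex : ℕ) : ℕ∞) : ℝ≥0∞) := ENat.toENNReal_mono hX
        _ = T + ∑ i ∈ Finset.range (Nat.find hex), (1 : ℝ≥0∞) := by simp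
        _ = T + ∑ i ∈ Finset.range (Nat.find hex),
              (toMeasurable μ (B (T + i))).indicator (1 : Ω → ℝ≥0∞) ω := by
            congr 1
            refine Finset.sum_congr rfl fun i hi => ?_
            rw [Set.indicator_of_mem (subset_toMeasurable μ _ (hmin i (Finset.mem_range.1 hi)))]
            rfl
        _ ≤ _ := by
            gcongr
            exact ENNReal.sum_le_tsum _
    · push Not at hex
      have : ∑' i, (toMeasurable μ (B (T + i))).indicator (1 : Ω → ℝ≥0∞) ω = ⊤ := by
        have h1 : ∀ i, (toMeasurable μ (B (T + i))).indicator (1 : Ω → ℝ≥0∞) ω = 1 := fun i =>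
          Set.indicator_of_mem (subset_toMeasurable μ _ (hex i)) _
        simp_rw [h1]
        exact ENNReal.tsum_const_eq_top_of_ne_zero one_ne_zero
      rw [this, add_top]
      exact le_top
  refine (lintegral_mono_ae hpt).trans ?_
  rw [lintegral_add_left measurable_const, lintegral_tsum fun i =>
    (measurable_one.indicator (measurableSet_toMeasurable μ _)).aemeasurable]
  simp [lintegral_indicator_one (measurableSet_toMeasurable μ _)]

theorem exists_pow_six {K : ℕ} {L m : ℝ} (hL : 0 < L) {t : ℕ} (ht0 : 1 ≤ t)
    (ht : m ^ 6 * (K ^ 3 / L ^ 6) ≤ t) :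
    ∃ x : ℝ, 0 < x ∧ x ^ 6 = t ∧ m ^ 2 * K ≤ x ^ 2 * L ^ 2 := by
  have htp : (0 : ℝ) < t := by exact_mod_cast ht0
  have hx6 : ((t : ℝ) ^ (((6 : ℕ) : ℝ)⁻¹)) ^ 6 = t :=
    Real.rpow_inv_natCast_pow htp.le (by norm_num)
  refine ⟨(t : ℝ) ^ (((6 : ℕ) : ℝ)⁻¹), by positivity, hx6, ?_⟩
  set x := (t : ℝ) ^ (((6 : ℕ) : ℝ)⁻¹)
  refine le_of_pow_le_pow_left₀ (n := 3) (by norm_num) (by positivity) ?_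
  rw [← hx6, ← mul_div_assoc, div_le_iff₀ (by positivity)] at ht
  calc (m ^ 2 * K) ^ 3 = m ^ 6 * K ^ 3 := by ring
    _ ≤ x ^ 6 * L ^ 6 := ht
    _ = (x ^ 2 * L ^ 2) ^ 3 := by ring

/-- At the detection time the distance dominates the sampling noise at level `α`. -/
theorem log_mul_le_of_detection {D σ α r : ℝ} {t : ℕ} (ht : 1 ≤ t) (hα : 0 < α) (hα1 : α < 1)
    (hσ : 0 ≤ σ) (hr : 0 ≤ r)
    (h : r + σ * Real.sqrt (Real.log (t / α) / t) + Real.log (t / α) / t ≤ D) :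
    Real.log (1 / α) * (2 * σ ^ 2 + 4 * D) ≤ 6 * D ^ 2 * t := by
  have ht1 : (1 : ℝ) ≤ t := by exact_mod_cast ht
  have hlog0 : 0 ≤ Real.log (1 / α) := Real.log_nonneg (by
    rw [le_div_iff₀ hα]; linarith)
  have hlog : Real.log (1 / α) ≤ Real.log (t / α) :=
    Real.log_le_log (by positivity) (by gcongr)
  set y := Real.log (t / α) / t with hy
  have hy0 : 0 ≤ y := div_nonneg (hlog0.trans hlog) (by positivity)
  have hly : Real.log (1 / α) ≤ y * t := by
    rw [hy, div_mul_cancel₀ _ (by positivity)]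
    exact hlog
  set q := Real.sqrt y with hq
  have hq0 : 0 ≤ q := Real.sqrt_nonneg _
  have hqq : y = q ^ 2 := (Real.sq_sqrt hy0).symm
  -- All three summands in `h` are nonnegative, so each is bounded by `D` separately.
  have h1 : σ * q ≤ D := by nlinarith [mul_nonneg hσ hq0]
  have h2 : y ≤ D := by nlinarith [mul_nonneg hσ hq0]
  have hD : 0 ≤ D := hy0.trans h2
  have h3 : σ ^ 2 * y ≤ D ^ 2 := by
    rw [hqq, ← mul_pow]
    exact pow_le_pow_left₀ (mul_nonneg hσ hq0) h1 2
  have h4 : y * (2 * σ ^ 2 + 4 * D) ≤ 6 * D ^ 2 := by nlinarith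
  calc Real.log (1 / α) * (2 * σ ^ 2 + 4 * D) ≤ y * t * (2 * σ ^ 2 + 4 * D) :=
        mul_le_mul_of_nonneg_right hly (by positivity)
    _ = y * (2 * σ ^ 2 + 4 * D) * t := by ring
    _ ≤ 6 * D ^ 2 * t := mul_le_mul_of_nonneg_right h4 (by positivity)

theorem exists_eq_detectionTime {D σ α : ℝ} {r : ℕ → ℝ} (h : detectionTime D σ α r ≠ ⊤) :
    ∃ t : ℕ, detectionTime D σ α r = t ∧ 1 ≤ t ∧
      r t + σ * Real.sqrt (Real.log (t / α) / t) + Real.log (t / α) / t ≤ D := by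
  obtain ⟨t, ht⟩ := ciInf_mem fun t : ℕ => ⨅ (_ : 1 ≤ t ∧
    r t + σ * Real.sqrt (Real.log (t / α) / t) + Real.log (t / α) / t ≤ D), (t : ℕ∞)
  change _ = detectionTime D σ α r at ht
  by_cases hp : 1 ≤ t ∧ r t + σ * Real.sqrt (Real.log (t / α) / t) + Real.log (t / α) / t ≤ D
  · simp only [ciInf_pos hp] at ht
    exact ⟨t, ht.symm, hp⟩
  · simp only [hp, iInf_false] at ht
    exact absurd ht.symm h

/-- The constant of the exploration time. -/
noncomputable def explorationTimeConst (M : ℝ) : ℝ :=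
  horizonScale M ^ 6 + 1 + ∑' n : ℕ, 4 / (n : ℝ) ^ 2

variable {K : ℕ} {𝒳 Ω : Type*} {Y : ℕ → Ω → Obs K 𝒳} {G : Set (𝒳 → ℝ)} {A : Prediction K 𝒳}
  [MeasurableSpace 𝒳] [MeasurableSpace Ω] {μ : Measure Ω} {P Q : Fin K → Measure 𝒳}
  {π : Selection K 𝒳}

theorem lintegral_stopTime_le [IsProbabilityMeasure μ]
    [∀ k, IsProbabilityMeasure (P k)] [∀ k, IsProbabilityMeasure (Q k)]
    [∀ n, IsMarkovKernel (π n)] {a : Fin K} {L M α ρ : ℝ}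
    (h : IsAlternative μ G P Q a L A π Y) (hα : 0 < α) (hα1 : α < 1)
    (hR : ∀ᵐ ω ∂μ, ∀ s : ℕ, regret G A a (history Y s ω)
        ≤ M * Real.sqrt (count a (history Y s ω))) (hρ : 0 ≤ ρ) {d : ℕ} (hd : 1 ≤ d)
    (hdet : ρ + stdev G (P a) (Q a) * Real.sqrt (Real.log (d / α) / d)
      + Real.log (d / α) / d ≤ dist G (P a) (Q a)) :
    ∫⁻ ω, (stopTime A (onsBetting A) α Y ω : ℝ≥0∞) ∂μ
      ≤ 192 * d + ENNReal.ofReal (explorationTimeConst M * (K ^ 3 / L ^ 6)) := by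
  have hG := h.testClass
  have hA := h.prediction
  have hL := h.L_pos
  have hK : (1 : ℝ) ≤ K := by exact_mod_cast a.pos
  have hD1 := dist_le_one hG (P a) (Q a)
  have hLD := le_dist_of_le_gap hG h.symmetric h.L_le_gap
  have hσ1 := stdev_le_one hG (P a) (Q a)
  have hσ0 := stdev_nonneg (G := G) (P a) (Q a)
  have hα' := log_mul_le_of_detection hd hα hα1 hσ0 hρ hdet
  set D := dist G (P a) (Q a) with hD
  set σ := stdev G (P a) (Q a) with hσ
  set E := horizonScale M ^ 6 * ((K : ℝ) ^ 3 / L ^ 6) with hE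
  have hE0 : 0 ≤ E := by positivity
  -- `192 = 32 · 6`: the 32 required by `le_wealth_of_sums` times the 6 supplied by
  -- `log_mul_le_of_detection` at time `d`.
  set T := 192 * d + ⌈E⌉₊ with hT
  have hbad : ∀ t, ∃ B : Set Ω, T ≤ t → μ B ≤ ENNReal.ofReal (4 / (t : ℝ) ^ 2) ∧ ∀ ω ∉ B,
      (∀ s : ℕ, regret G A a (history Y s ω) ≤ M * Real.sqrt (count a (history Y s ω))) →
      stopTime A (onsBetting A) α Y ω ≤ t := fun t => by
    by_cases htT : T ≤ t
    · have ht1 : 1 ≤ t := by omega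
      have htE : E ≤ t := (Nat.le_ceil E).trans (by
        exact_mod_cast (Nat.le_add_left _ _).trans htT)
      have htd : 192 * (d : ℝ) ≤ t := by
        exact_mod_cast (Nat.le_add_right (192 * d) ⌈E⌉₊).trans htT
      obtain ⟨x, hx, hxt, hxm⟩ := exists_pow_six hL ht1 htE
      obtain ⟨B, hB, hBω⟩ := exists_bad_set h hx hxm hxt
      refine ⟨B, fun _ => ⟨hB, fun ω hω hRω => ?_⟩⟩
      obtain ⟨h1, h2⟩ := hBω ω hω hRω
      refine stopTime_le_of_wealth ht1 (le_wealth_of_sums hG hA hα hα1 (hL.trans_le hLD) hD1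
        hσ0 hσ1 h1 h2 ?_ ?_)
      · have h3 := mul_log_le a.pos hL (hLD.trans hD1) hx hxm
        rw [hxt] at h3
        exact h3.trans (mul_le_mul_of_nonneg_right (pow_le_pow_left₀ hL.le hLD 2)
          (Nat.cast_nonneg t))
      · have := mul_le_mul_of_nonneg_left htd (sq_nonneg D)
        linarith
    · exact ⟨∅, fun h => absurd h htT⟩
  choose B hB using hbad
  have hsummable : Summable fun n : ℕ => 4 / (n : ℝ) ^ 2 := by
    simpa only [mul_one_div] using
      (Real.summable_one_div_nat_pow.2 (by norm_num : 1 < 2)).mul_left (4 : ℝ)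
  set Z := ∑' n : ℕ, 4 / (n : ℝ) ^ 2 with hZ
  have hZ0 : 0 ≤ Z := tsum_nonneg fun n => by positivity
  have hsum : ∑' i, μ (B (T + i)) ≤ ENNReal.ofReal Z := by
    calc ∑' i, μ (B (T + i)) ≤ ∑' i, ENNReal.ofReal (4 / ((T + i : ℕ) : ℝ) ^ 2) :=
          ENNReal.tsum_le_tsum fun i => (hB _ (Nat.le_add_right T i)).1
      _ ≤ ∑' n : ℕ, ENNReal.ofReal (4 / (n : ℝ) ^ 2) :=
          ENNReal.tsum_comp_le_tsum_of_injective (add_right_injective T)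
            fun n : ℕ => ENNReal.ofReal (4 / (n : ℝ) ^ 2)
      _ = ENNReal.ofReal Z :=
          (ENNReal.ofReal_tsum_of_nonneg (fun n => by positivity) hsummable).symm
  have hτ := lintegral_enat_le (μ := μ) (X := stopTime A (onsBetting A) α Y) (B := B) T (by
    filter_upwards [hR] with ω hω n hn hnB
    exact (hB n hn).2 ω hnB hω)
  -- This absorbs the rounding of `E` and the sum `Z` into the constant multiplying `K³ / L⁶`.
  have hKL : 1 ≤ (K : ℝ) ^ 3 / L ^ 6 := by
    rw [le_div_iff₀ (by positivity), one_mul]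
    exact (pow_le_one₀ hL.le (hLD.trans hD1)).trans (one_le_pow₀ hK)
  calc ∫⁻ ω, (stopTime A (onsBetting A) α Y ω : ℝ≥0∞) ∂μ
      ≤ T + ENNReal.ofReal Z := hτ.trans (add_le_add le_rfl hsum)
    _ = 192 * d + (ENNReal.ofReal ⌈E⌉₊ + ENNReal.ofReal Z) := by
        rw [hT, ENNReal.ofReal_natCast]
        push_cast
        ring
    _ ≤ 192 * d + ENNReal.ofReal (explorationTimeConst M * (K ^ 3 / L ^ 6)) := by
        rw [← ENNReal.ofReal_add (Nat.cast_nonneg _) hZ0]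
        gcongr
        rw [explorationTimeConst, ← hZ]
        have := (Nat.ceil_lt_add_one hE0).le
        nlinarith

end ActiveTest

theorem theorem1 :
    -- level `α`, for all prediction, betting and selection strategies
    (∀ (K : ℕ) (𝒳 : Type u) [MeasurableSpace 𝒳] (Ω : Type v) [MeasurableSpace Ω]
      (μ : Measure Ω) [IsProbabilityMeasure μ]
      (G : Set (𝒳 → ℝ)) (P Q : Fin K → Measure 𝒳)
      [∀ k, IsProbabilityMeasure (P k)] [∀ k, IsProbabilityMeasure (Q k)]
      (A : ActiveTest.Prediction K 𝒳) (B : ActiveTest.Betting K 𝒳)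
      (π : ActiveTest.Selection K 𝒳) [∀ n, IsMarkovKernel (π n)]
      (Y : ℕ → Ω → ActiveTest.Obs K 𝒳) (α : ℝ),
      ActiveTest.IsTestClass G → ActiveTest.IsSymmetricClass G →
      ActiveTest.IsPrediction G A → ActiveTest.IsBetting B →
      ActiveTest.IsSampling μ P Q π Y → 0 < α → α < 1 →
      (∀ k, P k = Q k) →
      μ {ω | ActiveTest.stopTime A B α Y ω < ⊤} ≤ ENNReal.ofReal α) ∧
    -- power one
    (∀ (K : ℕ) (𝒳 : Type u) [MeasurableSpace 𝒳] (Ω : Type v) [MeasurableSpace Ω]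
      (μ : Measure Ω) [IsProbabilityMeasure μ]
      (G : Set (𝒳 → ℝ)) (P Q : Fin K → Measure 𝒳)
      [∀ k, IsProbabilityMeasure (P k)] [∀ k, IsProbabilityMeasure (Q k)]
      (a : Fin K) (L : ℝ) (A : ActiveTest.Prediction K 𝒳)
      (π : ActiveTest.Selection K 𝒳) [∀ n, IsMarkovKernel (π n)]
      (Y : ℕ → Ω → ActiveTest.Obs K 𝒳) (α : ℝ),
      ActiveTest.IsAlternative μ G P Q a L A π Y → 0 < α → α < 1 →
      (∀ᵐ ω ∂μ, limsup (fun t : ℕ =>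
        ActiveTest.regret G A a (ActiveTest.history Y t ω) / t
          - (1 / t) * ∑ s ∈ Finset.range t,
              if (Y s ω).1 = a then ActiveTest.dist G (P a) (Q a) else 0) atTop < 0) →
      μ {ω | ActiveTest.stopTime A (ActiveTest.onsBetting A) α Y ω < ⊤} = 1) ∧
    -- expected stopping time
    (∃ (c : ℝ≥0) (q : ℕ) (cM : ℝ → ℝ),
      ∀ (K : ℕ) (𝒳 : Type u) [MeasurableSpace 𝒳] (Ω : Type v) [MeasurableSpace Ω]
      (μ : Measure Ω) [IsProbabilityMeasure μ]
      (G : Set (𝒳 → ℝ)) (P Q : Fin K → Measure 𝒳)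
      [∀ k, IsProbabilityMeasure (P k)] [∀ k, IsProbabilityMeasure (Q k)]
      (a : Fin K) (L : ℝ) (A : ActiveTest.Prediction K 𝒳)
      (π : ActiveTest.Selection K 𝒳) [∀ n, IsMarkovKernel (π n)]
      (Y : ℕ → Ω → ActiveTest.Obs K 𝒳) (α M : ℝ) (r : ℕ → ℝ),
      ActiveTest.IsAlternative μ G P Q a L A π Y → 0 < α → α < 1 →
      (∀ᵐ ω ∂μ, ∀ t : ℕ, ActiveTest.regret G A a (ActiveTest.history Y t ω)
        ≤ M * Real.sqrt (ActiveTest.count a (ActiveTest.history Y t ω))) →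
      (∀ t, 1 ≤ t → 0 ≤ r t) → Tendsto r atTop (𝓝 0) →
      ∑' t : ℕ, μ {ω | ActiveTest.regret G A a (ActiveTest.history Y (t + 1) ω)
        / ((t + 1 : ℕ) : ℝ) ≤ r (t + 1)}ᶜ ≠ ⊤ →
      ∫⁻ ω, ((ActiveTest.stopTime A (ActiveTest.onsBetting A) α Y ω : ℕ∞) : ℝ≥0∞) ∂μ
        ≤ c * (((ActiveTest.detectionTime (ActiveTest.dist G (P a) (Q a))
                (ActiveTest.stdev G (P a) (Q a)) α r : ℕ∞) : ℝ≥0∞)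
          + ∑' t : ℕ, μ {ω | ActiveTest.regret G A a (ActiveTest.history Y (t + 1) ω)
              / ((t + 1 : ℕ) : ℝ) ≤ r (t + 1)}ᶜ
          + ENNReal.ofReal (cM M * (K ^ 3 / L ^ 6) * (1 + Real.log (K / L)) ^ q))) := by
  -- The exponent of the logarithm can be 0, since the horizon is a pure power of `K` and `1 / L`.
  refine ⟨?_, ?_, 192, 0, ActiveTest.explorationTimeConst, ?_⟩
  · intro K 𝒳 _ Ω _ μ _ G P Q _ _ A B π _ Y α hG _ hA hB hY hα _ hPQ
    exact ActiveTest.measure_stopTime_lt_top_le hG hA hB hY hα hPQ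
  · intro K 𝒳 _ Ω _ μ _ G P Q _ _ a L A π _ Y α h hα hα1 hR
    exact ActiveTest.measure_stopTime_lt_top_eq_one h hα hα1 hR
  · intro K 𝒳 _ Ω _ μ _ G P Q _ _ a L A π _ Y α M r h hα hα1 hR hr _ _
    -- If the detection time is infinite, so is the right-hand side.
    by_cases htop : ActiveTest.detectionTime (ActiveTest.dist G (P a) (Q a))
        (ActiveTest.stdev G (P a) (Q a)) α r = ⊤
    · rw [htop]
      simp
    · obtain ⟨d, hd, hd1, hdet⟩ := ActiveTest.exists_eq_detectionTime htop
      refine (ActiveTest.lintegral_stopTime_le h hα hα1 hR (hr d hd1) hd1 hdet).trans ?_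
      rw [hd, pow_zero, mul_one, ENat.toENNReal_coe, mul_add, mul_add]
      have h192 : (((192 : ℝ≥0) : ℝ≥0∞)) = 192 := by norm_num
      rw [h192]
      gcongr
      · exact le_self_add
      · exact le_mul_of_one_le_left zero_le (by norm_num)
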